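/- An $n$-chord diagram is an oriented circle with $2n$ distinct points paired into $n$ disjoint pairs (chords), up to orientation-preserving diffeomorphisms of the circle; with the points labelled $1,2,\dots,2n$ counterclockwise it is written as the list of its chords $(p_i,p_i^*)$, $1\le i\le n$. The universal $\mathrm{sl}_2$ weight $\varphi=\varphi_{\mathrm{sl}_2,2}$ is the unique function from chord diagrams to $\mathbb{Z}[x]$ such that $\varphi=x$ on the $1$-chord diagram and, for every $n$-chord diagram $\mathcal{D}$ with $n\ge 2$ and every chord $a$ of $\mathcal{D}$, $$\varphi(\mathcal{D})=(x-k)\,\varphi(\mathcal{D}_a)+\sum_{\{i,j\}\subset I_a}\bigl(\varphi(\mathcal{D}^1_{i,j})-\varphi(\mathcal{D}^2_{i,j})\bigr).$$ Here $\mathcal{D}_a$ is $\mathcal{D}$ with the chord $a$ deleted, $I_a$ indexes the chords of $\mathcal{D}$ that intersect $a$, $k=\#I_a$, the sum is over unordered pairs of distinct indices, and, writing each chord of $I_a$ as $(p_i,p_i^*)$ with $p_i$ on one fixed side of $a$ and $p_i^*$ on the other, $\mathcal{D}^1_{i,j}$ (resp. $\mathcal{D}^2_{i,j}$) is obtained from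 $\mathcal{D}_a$ by replacing the chords $(p_i,p_i^*)$ and $(p_j,p_j^*)$ by $(p_i,p_j)$ and $(p_i^*,p_j^*)$ (resp. by $(p_i,p_j^*)$ and $(p_j,p_i^*)$). Let $\mathcal{D}_n=((i,n+i):1\le i\le n)$ be the diagram in which every chord meets every other chord. For $n\ge1$ and $0\le k\le n-1$ let $\mathcal{A}_{n,k}$ be the $n$-chord diagram with chords $(p_i,p_i^*)$, $1\le i\le n$, whose endpoints are, counterclockwise, $$p_1,p_2,\dots,p_{k+1},\;p_1^*,\;p_{k+2},\dots,p_n,\;p_2^*,p_3^*,\dots,p_n^*.$$ For $0\le k\le n-2$ let $\mathcal{B}_{n,k}$ be the $n$-chord diagram whose endpoints are, counterclockwise, $$p_1,p_2,\dots,p_{k+1},\;p_1^*,\;p_{k+2},\dots,p_n,\;p_2^*,\dots,p_{k+1}^*,\;p_n^*,\;p_{k+2}^*,\dots,p_{n-1}^*,$$ and let $\mathcal{B}_{n,n-1}=\mathcal{D}_n$. Put $A_{n,k}=\varphi(\mathcal{A}_{n,k})$ and $B_{n,k}=\varphi(\mathcal{B}_{n,k})$ for $0\le k\le n-1$, and $A_{n,-1}=0$,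 $B_{n,-1}=-x\,\varphi(\mathcal{D}_n)$. Let $(K_{n,k})_{1\le k\le n}$ be the polynomials defined by $K_{1,1}=x$ and, for $n\ge 2$ and $3\le k\le n$, $$K_{n,1}=(x-1)K_{n-1,1}-K_{n-1,2}-\dots-K_{n-1,n-1},$$ $$K_{n,2}=2K_{n,1}+K_{n-1,1}-x^2K_{n-2,1},$$ $$K_{n,k}=2K_{n,k-1}-K_{n,k-2}+K_{n-1,k-1}+K_{n-1,k-2}+2xK_{n-2,k-2},$$ with $K_{0,1}=1$, and put $K_{n,0}=-xK_{n,1}$ for all $n\ge 0$. Theorem. The function $\varphi$ is well defined, and for all $n\ge1$ and $0\le k\le n-1$, $$A_{n,k-1}-A_{n,k}=K_{n-1,k},\qquad B_{n,k-1}-B_{n,n-k-1}=K_{n,k}-K_{n,k+1}.$$ In particular $\varphi(\mathcal{D}_n)=K_{n,1}$ for all $n\ge1$. -/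

import Mathlib

open Polynomial

namespace ChordWeight

/-! ### Chord diagrams

The marked points of the oriented circle are represented by natural numbers, met in increasing
order when one goes around the circle counterclockwise from a base point. The labels need not be
consecutive: only the cyclic order of the points matters. A chord is an unordered pair of points,
and a diagram is the finite set of its chords; its order is the number of its chords. -/

/-- The marked points of a set of chords. -/
def points (D : Finset (Sym2 ℕ)) : Finset ℕ := D.biUnion fun c => c.toFinset

/-- `D` is a chord diagram: every chord has two distinct endpoints, and distinct chords have no
common endpoint. -/
def IsChordDiagram (D : Finset (Sym2 ℕ)) : Prop :=
  (∀ c ∈ D, ¬ c.IsDiag) ∧ ∀ c ∈ D, ∀ d ∈ D, c ≠ d → ∀ p : ℕ, p ∈ c → p ∉ d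

/-- `p`, `q`, `r` are distinct and met in this cyclic order counterclockwise. -/
def CyclicallyOrdered (p q r : ℕ) : Prop :=
  (p < q ∧ q < r) ∨ (q < r ∧ r < p) ∨ (r < p ∧ p < q)

/-- `D` and `D'` represent the same chord diagram up to orientation-preserving diffeomorphism of
the circle: some cyclic-order-preserving relabelling of the points carries `D` to `D'`. -/
def SameDiagram (D D' : Finset (Sym2 ℕ)) : Prop :=
  ∃ f : ℕ → ℕ, Set.InjOn f (points D) ∧ D' = D.image (Sym2.map f) ∧
    ∀ p ∈ points D, ∀ q ∈ points D, ∀ r ∈ points D,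
      CyclicallyOrdered p q r → CyclicallyOrdered (f p) (f q) (f r)

/-! ### The universal sl₂ weight -/

/-- The chords of `D` that intersect the chord `a`, each written as a pair `(p, p*)` whose first
entry `p` is the endpoint that lies on one fixed side of `a` (strictly between the two labels
of `a`) and whose second entry `p*` is the endpoint on the other side. -/
def crossing (D : Finset (Sym2 ℕ)) (a : Sym2 ℕ) : Finset (ℕ × ℕ) :=
  (points D ×ˢ points D).filter fun c =>
    s(c.1, c.2) ∈ D ∧ (a.inf < c.1 ∧ c.1 < a.sup) ∧ (c.2 < a.inf ∨ a.sup < c.2)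

/-- Delete `a` from `D` and replace the chords `c = (p, p*)` and `d = (q, q*)` by `(p, q)` and
`(p*, q*)`. -/
def reconnectSame (D : Finset (Sym2 ℕ)) (a : Sym2 ℕ) (c d : ℕ × ℕ) : Finset (Sym2 ℕ) :=
  insert s(c.1, d.1) (insert s(c.2, d.2) (((D.erase a).erase s(c.1, c.2)).erase s(d.1, d.2)))

/-- Delete `a` from `D` and replace the chords `c = (p, p*)` and `d = (q, q*)` by `(p, q*)` and
`(q, p*)`. -/
def reconnectCross (D : Finset (Sym2 ℕ)) (a : Sym2 ℕ) (c d : ℕ × ℕ) : Finset (Sym2 ℕ) :=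
  insert s(c.1, d.2) (insert s(d.1, c.2) (((D.erase a).erase s(c.1, c.2)).erase s(d.1, d.2)))

/-- The right-hand side of the Chmutov–Varchenko recursion for `D` along its chord `a`:
`(x - k) φ(D_a) + ∑_{i,j} (φ(D¹_{i,j}) - φ(D²_{i,j}))`, where `k` is the number of chords that
intersect `a` and the sum is over the unordered pairs of such chords (each pair is listed once, by
requiring `p < q`). -/
noncomputable def recursionRHS (φ : Finset (Sym2 ℕ) → ℤ[X]) (D : Finset (Sym2 ℕ)) (a : Sym2 ℕ) :
    ℤ[X] :=
  (X - ((crossing D a).card : ℤ[X])) * φ (D.erase a) +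
    ∑ cd ∈ (crossing D a ×ˢ crossing D a).filter (fun cd => cd.1.1 < cd.2.1),
      (φ (reconnectSame D a cd.1 cd.2) - φ (reconnectCross D a cd.1 cd.2))

/-- The weight computed in `n` steps of the recursion, each along an arbitrarily chosen chord. -/
noncomputable def weightAux : ℕ → Finset (Sym2 ℕ) → ℤ[X]
  | 0, _ => 1
  | n + 1, D =>
    open Classical in
    if h : D.Nonempty then recursionRHS (weightAux n) D h.choose else 0

/-- The universal sl₂ weight `φ = φ_{sl₂,2}`. The empty diagram has weight `1`, so that the
diagram with one chord has weight `x`. -/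
noncomputable def weight (D : Finset (Sym2 ℕ)) : ℤ[X] := weightAux D.card D

/-- The properties that make `φ` the universal sl₂ weight on chord diagrams: the one-chord diagram
has weight `x`, the recursion holds for *every* chord of every diagram of order at least `2`,
and equal diagrams have equal weights. -/
structure IsUniversalSl2Weight (φ : Finset (Sym2 ℕ) → ℤ[X]) : Prop where
  one_chord : ∀ D, IsChordDiagram D → D.card = 1 → φ D = X
  recursion : ∀ D, IsChordDiagram D → 2 ≤ D.card → ∀ a ∈ D, φ D = recursionRHS φ D a
  invariant : ∀ D D', IsChordDiagram D → IsChordDiagram D' → SameDiagram D D' → φ D = φ D'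

/-! ### The families of diagrams -/

/-- `𝒟_n`, with chords `(i, n + i)`, `1 ≤ i ≤ n`: all chords intersect each other. -/
def diagramD (n : ℕ) : Finset (Sym2 ℕ) :=
  (Finset.Icc 1 n).image fun i => s(i, n + i)

/-- `𝒜_{n,k}`, `0 ≤ k ≤ n - 1`: the points are, counterclockwise,
`p_1, p_2, …, p_{k+1}, p_1*, p_{k+2}, …, p_n, p_2*, …, p_n*`. -/
def diagramA (n k : ℕ) : Finset (Sym2 ℕ) :=
  (Finset.Icc 1 n).image fun i =>
    if i = 1 then s(1, k + 2)
    else if i ≤ k + 1 then s(i, n + i)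
    else s(i + 1, n + i)

/-- `ℬ_{n,k}`: for `0 ≤ k ≤ n - 2` the points are, counterclockwise,
`p_1, p_2, …, p_{k+1}, p_1*, p_{k+2}, …, p_n, p_2*, …, p_{k+1}*, p_n*, p_{k+2}*, …, p_{n-1}*`;
for `k = n - 1` it is `𝒟_n`. -/
def diagramB (n k : ℕ) : Finset (Sym2 ℕ) :=
  (Finset.Icc 1 n).image fun i =>
    if i = 1 then s(1, k + 2)
    else if i ≤ k + 1 then s(i, n + i)
    else if i < n then s(i + 1, n + i + 1)
    else s(n + 1, n + k + 2)

/-- `A_{n,k} = φ(𝒜_{n,k})` for `k ≥ 0`, and `A_{n,-1} = 0`. -/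
noncomputable def polyA (n : ℕ) (k : ℤ) : ℤ[X] :=
  if k < 0 then 0 else weight (diagramA n k.toNat)

/-- `B_{n,k} = φ(ℬ_{n,k})` for `k ≥ 0`, and `B_{n,-1} = -x φ(𝒟_n)`. -/
noncomputable def polyB (n : ℕ) (k : ℤ) : ℤ[X] :=
  if k < 0 then -X * weight (diagramD n) else weight (diagramB n k.toNat)

/-! ### The polynomial Kreweras triangle -/

/-- The triangle `K_{n,k}` for `1 ≤ k ≤ n`, with `K_{0,1} = 1`; the other values are junk. -/
noncomputable def krewerasAux : ℕ → ℕ → ℤ[X]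
  | 0, _ => 1
  | 1, _ => X
  | _ + 2, 0 => 0
  | n + 2, 1 => (X - 1) * krewerasAux (n + 1) 1 - ∑ i ∈ Finset.Icc 2 (n + 1), krewerasAux (n + 1) i
  | n + 2, 2 => 2 * krewerasAux (n + 2) 1 + krewerasAux (n + 1) 1 - X ^ 2 * krewerasAux n 1
  | n + 2, k + 3 =>
    2 * krewerasAux (n + 2) (k + 2) - krewerasAux (n + 2) (k + 1) + krewerasAux (n + 1) (k + 2)
      + krewerasAux (n + 1) (k + 1) + 2 * X * krewerasAux n (k + 1)

/-- The triangle `K_{n,k}` for `0 ≤ k ≤ n`, with `K_{n,0} = -x K_{n,1}` and `K_{0,1} = 1`. -/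
noncomputable def kreweras (n k : ℕ) : ℤ[X] :=
  if k = 0 then -X * krewerasAux n 1 else krewerasAux n k

end ChordWeight

/-!
A polynomial is determined by its values at the infinitely many Casimir eigenvalues of the
nontrivial irreducible representations of `sl₂`, so that every identity is checked in one such
representation, of Casimir eigenvalue `x` and with normalized trace `tr`. Put a basis element of
`sl₂` at each endpoint of a chord diagram, multiply them in the counterclockwise order, take the
trace, and contract the two endpoints of every chord. For the endpoints of a chord `a` the
contraction is `∑ J P J = x P - ½ ∑ [J, [J, P]]`, where `P` is the word on one side of `a`. Since
the invariant tensors of the chords that do not cross `a` are killed by the action of `sl₂`, the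
double commutator becomes a sum over pairs of chords that cross `a`: this is the recursion.
Cyclicity of the trace makes the value invariant under rotation.

In the tensor square of the representation, with `left` and `right` the two actions and
`Ω = ∑ left_s right_s`, the trace of `u ⊗ v ↦ u v` turns `𝒟_n`, `𝒜_{n,k}` and `ℬ_{n,k}` into
`Ω ^ n`, `∑ left_s Ω ^ k left_s Ω ^ (n-k-1)` and
`∑ left_s right_t Ω ^ k left_s right_t Ω ^ (n-k-2)`. The double commutator of `Ω` with `left_s` is
quadratic in `Ω`, `left` and `right`, which gives a cubic relation between `Ω` and `left_s` and with
it the recurrence of `K` for the differences of `A_{n,k}`; the single commutators `[left_s, Ω]`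
express the second differences of `A_{n,k}` by `B_{n,k}`.
-/

namespace ChordWeight

/-! ### Structure constants of `sl₂` -/

/-- The Levi-Civita symbol, as the Vandermonde product of its indices divided by `2`. -/
def leviCivita (a b c : Fin 3) : ℤ := ((b : ℤ) - a) * ((c : ℤ) - a) * ((c : ℤ) - b) / 2

/-- The structure constants of `sl₂` in an orthonormal basis, normalized so that the Casimir
element acts on the representation of dimension `2l + 1` as `l(l + 1)`. -/
noncomputable def structureConst (a b c : Fin 3) : ℂ := Complex.I * leviCivita a b c

theorem structureConst_swap_right (a b c : Fin 3) :
    structureConst a b c = -structureConst a c b := by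
  have h : leviCivita a b c = -leviCivita a c b := by revert a b c; decide
  simp [structureConst, h]

theorem structureConst_swap_left (a b c : Fin 3) :
    structureConst a b c = -structureConst b a c := by
  have h : leviCivita a b c = -leviCivita b a c := by revert a b c; decide
  simp [structureConst, h]

theorem structureConst_mul (a b c a' b' c' : Fin 3) :
    structureConst a b c * structureConst a' b' c' =
      -((leviCivita a b c * leviCivita a' b' c' : ℤ) : ℂ) := by
  simp only [structureConst, Int.cast_mul]
  linear_combination (leviCivita a b c : ℂ) * leviCivita a' b' c' * Complex.I_mul_I

theorem sum_leviCivita_mul (a b c d : Fin 3) :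
    ∑ t, leviCivita t a b * leviCivita t c d =
      (if a = c then 1 else 0) * (if b = d then 1 else 0) -
        (if a = d then 1 else 0) * (if b = c then 1 else 0) := by
  revert a b c d; decide

theorem sum_structureConst_mul (a b c d : Fin 3) :
    ∑ t, structureConst t a b * structureConst t c d =
      (if a = d then 1 else 0) * (if b = c then 1 else 0) -
        (if a = c then 1 else 0) * (if b = d then 1 else 0) := by
  simp only [structureConst_mul, Finset.sum_neg_distrib, ← Int.cast_sum, sum_leviCivita_mul]
  push_cast
  ring

theorem sum_structureConst_mul_structureConst (a b : Fin 3) :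
    ∑ t, ∑ c, structureConst t a c * structureConst t c b = if a = b then 2 else 0 := by
  rw [Finset.sum_comm]
  simp only [sum_structureConst_mul]
  fin_cases a <;> fin_cases b <;> norm_num [Fin.sum_univ_three]

/-! ### Sums over colourings -/

section ColorSum

variable {α β ι M : Type*}

theorem update_eq_of_dependsOn [DecidableEq α] {F : (α → ι) → M} {s : Set α}
    (hF : DependsOn F s) {p : α} (hp : p ∉ s) (κ : α → ι) (c : ι) :
    F (Function.update κ p c) = F κ :=
  hF fun _ hq => Function.update_of_ne (ne_of_mem_of_not_mem hq hp) _ _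

theorem dependsOn_mul [Mul M] {F G : (α → ι) → M} {s t : Set α} (hF : DependsOn F s)
    (hG : DependsOn G t) : DependsOn (F * G) (s ∪ t) :=
  fun _ _ h => congrArg₂ (· * ·) (hF fun p hp => h p (.inl hp)) (hG fun p hp => h p (.inr hp))

variable [DecidableEq α] [DecidableEq β] [Fintype ι] [AddCommGroup M] [Module ℂ M]

/-- Summation over the colour of the point `p`, as an operator on functions of a colouring of all
points. -/
noncomputable def colorSumAt (p : α) : Module.End ℂ ((α → ι) → M) where
  toFun F κ := ∑ c, F (Function.update κ p c)
  map_add' F G := funext fun _ => Finset.sum_add_distrib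
  map_smul' r F := funext fun _ => by simp [Finset.smul_sum]

theorem colorSumAt_apply (p : α) (F : (α → ι) → M) (κ : α → ι) :
    colorSumAt p F κ = ∑ c, F (Function.update κ p c) := rfl

theorem commute_colorSumAt (p q : α) :
    Commute (colorSumAt p : Module.End ℂ ((α → ι) → M)) (colorSumAt q) := by
  rcases eq_or_ne p q with rfl | h
  · exact Commute.refl _
  · ext F κ
    simp only [Module.End.mul_apply, colorSumAt_apply]
    rw [Finset.sum_comm]
    simp_rw [Function.update_comm h]

theorem colorSumAt_mul_of_dependsOn {F : (α → ι) → ℂ} {s : Set α} (hF : DependsOn F s) {p : α}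
    (hp : p ∉ s) (G : (α → ι) → ℂ) : colorSumAt p (F * G) = F * colorSumAt p G := by
  funext κ
  simp only [colorSumAt_apply, Pi.mul_apply, update_eq_of_dependsOn hF hp, Finset.mul_sum]

theorem pairwise_commute_colorSumAt (S : Finset α) :
    (S : Set α).Pairwise (Function.onFun Commute
      (colorSumAt : α → Module.End ℂ ((α → ι) → M))) :=
  fun p _ q _ _ => commute_colorSumAt p q

/-- Summation over the colours of all points of `S`. -/
noncomputable def colorSum (S : Finset α) : Module.End ℂ ((α → ι) → M) :=
  S.noncommProd colorSumAt (pairwise_commute_colorSumAt S)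

@[simp] theorem colorSum_empty (F : (α → ι) → M) : colorSum ∅ F = F := by
  simp [colorSum]

theorem colorSum_insert {p : α} {S : Finset α} (hp : p ∉ S) (F : (α → ι) → M) :
    colorSum (insert p S) F = colorSum S (colorSumAt p F) := by
  rw [colorSum, Finset.noncommProd_insert_of_notMem' _ _ _ _ hp]
  rfl

theorem colorSum_insert_left {p : α} {S : Finset α} (hp : p ∉ S) (F : (α → ι) → M) :
    colorSum (insert p S) F = colorSumAt p (colorSum S F) := by
  rw [colorSum, Finset.noncommProd_insert_of_notMem _ _ _ _ hp]
  rfl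

theorem colorSum_union {S T : Finset α} (h : Disjoint S T) (F : (α → ι) → M) :
    colorSum (S ∪ T) F = colorSum S (colorSum T F) := by
  rw [colorSum, Finset.noncommProd_union_of_disjoint h]
  rfl

/-- The points of `T` are those whose colours have already been fixed: it grows in the induction
on `S`. -/
theorem colorSum_image_of_eqOn {f : α → β} {S T : Finset α}
    (hf : Set.InjOn f (S ∪ T : Finset α)) {F : (α → ι) → M}
    (hF : DependsOn F (S ∪ T : Finset α)) {κ : α → ι} {κ' : β → ι}
    (h : ∀ p ∈ T, κ' (f p) = κ p) :
    colorSum (S.image f) (fun κ' => F (κ' ∘ f)) κ' = colorSum S F κ := by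
  induction S using Finset.induction_on generalizing T κ κ' with
  | empty =>
    rw [Finset.image_empty, colorSum_empty, colorSum_empty]
    exact hF fun p hp => h p (by simpa using hp)
  | insert p S hp ih =>
    have hfp : ∀ q ∈ S ∪ T, q ≠ p → f q ≠ f p := fun q hq hqp h =>
      hqp (hf (by simp_all) (by simp) h)
    have hp' : f p ∉ S.image f := by
      simp only [Finset.mem_image, not_exists, not_and]
      exact fun q hq => hfp q (by simp [hq]) (ne_of_mem_of_not_mem hq hp)
    rw [Finset.image_insert, colorSum_insert_left hp', colorSum_insert_left hp, colorSumAt_apply,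
      colorSumAt_apply]
    rw [Finset.insert_union, ← Finset.union_insert] at hf hF
    refine Finset.sum_congr rfl fun c _ => ih hf hF fun q hq => ?_
    rcases eq_or_ne q p with rfl | hqp
    · simp
    · have hqT : q ∈ T := Finset.mem_of_mem_insert_of_ne hq hqp
      rw [Function.update_of_ne (hfp q (by simp [hqT]) hqp), Function.update_of_ne hqp, h q hqT]

theorem colorSum_image {f : α → β} {S : Finset α} (hf : Set.InjOn f S) {F : (α → ι) → M}
    (hF : DependsOn F (S : Set α)) (κ : α → ι) (κ' : β → ι) :
    colorSum (S.image f) (fun κ' => F (κ' ∘ f)) κ' = colorSum S F κ :=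
  colorSum_image_of_eqOn (T := ∅) (by simpa using hf) (by simpa using hF) (by simp)

end ColorSum

/-! ### The action of `sl₂` on functions of a colouring -/

section Action

variable {α M N A : Type*} [DecidableEq α] [AddCommGroup M] [Module ℂ M] [AddCommGroup N]
  [Module ℂ N] [Ring A] [Algebra ℂ A]

/-- The adjoint action of the basis element `t` of `sl₂` on the tensor factor at the point `p`: a
function of a colouring by `Fin 3` lists the coordinates of a tensor with one factor `sl₂` for each
point. -/
noncomputable def act (t : Fin 3) (p : α) : Module.End ℂ ((α → Fin 3) → M) where
  toFun F κ := ∑ l, structureConst t (κ p) l • F (Function.update κ p l)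
  map_add' F G := funext fun _ => by simp [Finset.sum_add_distrib]
  map_smul' r F := funext fun κ => by
    simp only [Pi.smul_apply, RingHom.id_apply, Finset.smul_sum]
    exact Finset.sum_congr rfl fun l _ => smul_comm _ _ _

theorem act_apply (t : Fin 3) (p : α) (F : (α → Fin 3) → M) (κ : α → Fin 3) :
    act t p F κ = ∑ l, structureConst t (κ p) l • F (Function.update κ p l) := rfl

theorem act_comm {p q : α} (h : p ≠ q) (t s : Fin 3) (F : (α → Fin 3) → M) :
    act t p (act s q F) = act s q (act t p F) := by
  funext κ
  simp only [act_apply, Function.update_of_ne h, Function.update_of_ne h.symm, Finset.smul_sum]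
  rw [Finset.sum_comm]
  refine Finset.sum_congr rfl fun l _ => Finset.sum_congr rfl fun m _ => ?_
  rw [smul_comm, Function.update_comm h]

theorem sum_act_act_self (p : α) (F : (α → Fin 3) → M) :
    ∑ t, act t p (act t p F) = (2 : ℂ) • F := by
  funext κ
  simp only [Finset.sum_apply, act_apply, Function.update_self, Function.update_idem,
    Finset.smul_sum, smul_smul, Pi.smul_apply]
  calc ∑ t, ∑ l, ∑ m, (structureConst t (κ p) l * structureConst t l m) • F (Function.update κ p m)
      = ∑ m, (∑ t, ∑ l, structureConst t (κ p) l * structureConst t l m) •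
          F (Function.update κ p m) := by
        simp only [Finset.sum_smul]
        exact (Finset.sum_congr rfl fun t _ => Finset.sum_comm).trans Finset.sum_comm
    _ = (2 : ℂ) • F κ := by simp [sum_structureConst_mul_structureConst]

theorem act_comp (t : Fin 3) (p : α) (g : M →ₗ[ℂ] N) (F : (α → Fin 3) → M) :
    act t p (fun κ => g (F κ)) = fun κ => g (act t p F κ) := by
  funext κ
  simp [act_apply]

theorem act_mul_of_dependsOn_right (t : Fin 3) {p : α} (F : (α → Fin 3) → A)
    {G : (α → Fin 3) → A} {s : Set α} (hG : DependsOn G s) (hp : p ∉ s) :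
    act t p (F * G) = act t p F * G := by
  funext κ
  simp [act_apply, update_eq_of_dependsOn hG hp, Finset.sum_mul]

theorem act_mul_of_dependsOn_left (t : Fin 3) {p : α} {F : (α → Fin 3) → A} {s : Set α}
    (hF : DependsOn F s) (hp : p ∉ s) (G : (α → Fin 3) → A) :
    act t p (F * G) = F * act t p G := by
  funext κ
  simp [act_apply, update_eq_of_dependsOn hF hp, Finset.mul_sum]

theorem colorSumAt_mul_act (t : Fin 3) (p : α) (F G : (α → Fin 3) → ℂ) :
    colorSumAt p (F * act t p G) = -colorSumAt p (act t p F * G) := by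
  funext κ
  simp only [colorSumAt_apply, act_apply, Pi.mul_apply, Pi.neg_apply, Function.update_self,
    Function.update_idem, smul_eq_mul, Finset.mul_sum, Finset.sum_mul, ← Finset.sum_neg_distrib]
  rw [Finset.sum_comm]
  refine Finset.sum_congr rfl fun c _ => Finset.sum_congr rfl fun l _ => ?_
  rw [structureConst_swap_right]
  ring

theorem colorSum_mul_act (t : Fin 3) {p : α} {S : Finset α} (hp : p ∈ S)
    (F G : (α → Fin 3) → ℂ) : colorSum S (F * act t p G) = -colorSum S (act t p F * G) := by
  rw [← Finset.insert_erase hp, colorSum_insert (Finset.notMem_erase p S),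
    colorSum_insert (Finset.notMem_erase p S), colorSumAt_mul_act, map_neg]

/-- The action of the basis element `t` of `sl₂` on the tensor factors at the points of `S`. -/
noncomputable def actSet (t : Fin 3) (S : Finset α) : Module.End ℂ ((α → Fin 3) → M) :=
  ∑ p ∈ S, act t p

theorem actSet_apply (t : Fin 3) (S : Finset α) (F : (α → Fin 3) → M) :
    actSet t S F = ∑ p ∈ S, act t p F :=
  LinearMap.sum_apply _ _ _

theorem actSet_insert (t : Fin 3) {p : α} {S : Finset α} (hp : p ∉ S) (F : (α → Fin 3) → M) :
    actSet t (insert p S) F = act t p F + actSet t S F := by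
  simp only [actSet_apply, Finset.sum_insert hp]

theorem actSet_comp (t : Fin 3) (S : Finset α) (g : M →ₗ[ℂ] N) (F : (α → Fin 3) → M) :
    actSet t S (fun κ => g (F κ)) = fun κ => g (actSet t S F κ) := by
  funext κ
  simp [actSet_apply, act_comp]

theorem actSet_mul_of_dependsOn_right (t : Fin 3) {S : Finset α} (F : (α → Fin 3) → A)
    {G : (α → Fin 3) → A} {s : Set α} (hG : DependsOn G s) (hS : ∀ p ∈ S, p ∉ s) :
    actSet t S (F * G) = actSet t S F * G := by
  simp only [actSet_apply, Finset.sum_mul]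
  exact Finset.sum_congr rfl fun p hp => act_mul_of_dependsOn_right t F hG (hS p hp)

theorem actSet_mul_of_dependsOn_left (t : Fin 3) {S : Finset α} {F : (α → Fin 3) → A} {s : Set α}
    (hF : DependsOn F s) (hS : ∀ p ∈ S, p ∉ s) (G : (α → Fin 3) → A) :
    actSet t S (F * G) = F * actSet t S G := by
  simp only [actSet_apply, Finset.mul_sum]
  exact Finset.sum_congr rfl fun p hp => act_mul_of_dependsOn_left t hF (hS p hp) G

theorem colorSum_mul_actSet (t : Fin 3) {S T : Finset α} (hST : S ⊆ T)
    (F G : (α → Fin 3) → ℂ) :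
    colorSum T (F * actSet t S G) = -colorSum T (actSet t S F * G) := by
  simp only [actSet_apply, Finset.mul_sum, Finset.sum_mul, map_sum, ← Finset.sum_neg_distrib]
  exact Finset.sum_congr rfl fun p hp => colorSum_mul_act t (hST hp) F G

end Action

/-! ### Words in a representation of `sl₂` with a trace -/

/-- An associative algebra with three elements `J a` that satisfy the commutation relations of an
orthonormal basis of `sl₂` and whose Casimir element is a scalar `x`, and with a normalized trace:
the data from which a weight system is built. -/
structure Sl2Trace (A : Type*) [Ring A] [Algebra ℂ A] where
  J : Fin 3 → A
  x : ℂ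
  tr : A →ₗ[ℂ] ℂ
  lie : ∀ a b, ⁅J a, J b⁆ = ∑ c, structureConst a b c • J c
  casimir : ∑ a, J a * J a = x • 1
  tr_mul_comm : ∀ a b, tr (a * b) = tr (b * a)
  tr_one : tr 1 = 1

namespace Sl2Trace

variable {α A : Type*} [Ring A] [Algebra ℂ A] (R : Sl2Trace A)

theorem sum_J_mul_mul_J (P : A) :
    ∑ t, R.J t * P * R.J t = R.x • P - (1 / 2 : ℂ) • ∑ t, ⁅R.J t, ⁅R.J t, P⁆⁆ := by
  have expand (t : Fin 3) : ⁅R.J t, ⁅R.J t, P⁆⁆ =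
      R.J t * R.J t * P + P * (R.J t * R.J t) - (2 : ℂ) • (R.J t * P * R.J t) := by
    rw [two_smul]
    simp only [Ring.lie_def]
    noncomm_ring
  simp only [expand, Finset.sum_sub_distrib, Finset.sum_add_distrib, ← Finset.sum_mul,
    ← Finset.mul_sum, ← Finset.smul_sum, R.casimir, smul_mul_assoc, mul_smul_comm, one_mul,
    mul_one]
  module

theorem sum_tr_J_mul_mul_J_mul (P Q : A) :
    ∑ t, R.tr (R.J t * P * R.J t * Q) =
      R.x * R.tr (P * Q) - 1 / 2 * ∑ t, R.tr (⁅R.J t, ⁅R.J t, P⁆⁆ * Q) := by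
  simp only [← map_sum, ← Finset.sum_mul, sum_J_mul_mul_J, sub_mul, smul_mul_assoc, map_sub,
    map_smul, smul_eq_mul]

theorem sum_J_mul_J_mul_J (c : Fin 3) : ∑ t, R.J t * R.J c * R.J t = (R.x - 1) • R.J c := by
  have hlie : ∑ t, ⁅R.J t, ⁅R.J t, R.J c⁆⁆ = (2 : ℂ) • R.J c := by
    calc ∑ t, ⁅R.J t, ⁅R.J t, R.J c⁆⁆
        = ∑ t, ∑ d, ∑ e, (structureConst t c d * structureConst t d e) • R.J e := by
          refine Finset.sum_congr rfl fun t _ => ?_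
          have hsum : ⁅R.J t, ∑ d, structureConst t c d • R.J d⁆ =
              ∑ d, structureConst t c d • ⁅R.J t, R.J d⁆ := by
            simp only [Ring.lie_def, Finset.mul_sum, Finset.sum_mul, mul_smul_comm,
              smul_mul_assoc, ← Finset.sum_sub_distrib, smul_sub]
          simp only [R.lie t c, hsum, R.lie, Finset.smul_sum, smul_smul]
      _ = ∑ e, (∑ t, ∑ d, structureConst t c d * structureConst t d e) • R.J e := by
          simp only [Finset.sum_smul]
          exact (Finset.sum_congr rfl fun t _ => Finset.sum_comm).trans Finset.sum_comm
      _ = (2 : ℂ) • R.J c := by simp [sum_structureConst_mul_structureConst]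
  rw [sum_J_mul_mul_J, hlie]
  module

/-- The product of the basis elements of `sl₂` given by the colours of the points of a list. -/
def word (L : List α) (κ : α → Fin 3) : A := (L.map fun p => R.J (κ p)).prod

@[simp] theorem word_nil (κ : α → Fin 3) : R.word [] κ = 1 := rfl

theorem word_cons (p : α) (L : List α) (κ : α → Fin 3) :
    R.word (p :: L) κ = R.J (κ p) * R.word L κ := by simp [word]

theorem word_append (L L' : List α) (κ : α → Fin 3) :
    R.word (L ++ L') κ = R.word L κ * R.word L' κ := by simp [word]

theorem word_map {β : Type*} (f : α → β) (L : List α) (κ : β → Fin 3) :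
    R.word (L.map f) κ = R.word L (κ ∘ f) := by simp [word, Function.comp_def]

theorem dependsOn_word (L : List α) : DependsOn (R.word L) {p | p ∈ L} := fun κ κ' h => by
  unfold word
  rw [List.map_congr_left fun p hp => by rw [h p hp]]

theorem word_update [DecidableEq α] {L : List α} {p : α} (hp : p ∉ L) (κ : α → Fin 3)
    (c : Fin 3) : R.word L (Function.update κ p c) = R.word L κ :=
  update_eq_of_dependsOn (R.dependsOn_word L) hp κ c

variable [DecidableEq α]

theorem act_letter (t : Fin 3) (p : α) :
    act t p (fun κ => R.J (κ p)) = fun κ => ⁅R.J t, R.J (κ p)⁆ := by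
  funext κ
  simp [act_apply, R.lie]

theorem actSet_word (t : Fin 3) {L : List α} (hL : L.Nodup) :
    actSet t L.toFinset (R.word L) = fun κ => ⁅R.J t, R.word L κ⁆ := by
  induction L with
  | nil => funext κ; simp [actSet_apply, Ring.lie_def]
  | cons p L ih =>
    obtain ⟨hp, hL⟩ := List.nodup_cons.1 hL
    have hword : R.word (p :: L) = (fun κ => R.J (κ p)) * R.word L :=
      funext fun κ => R.word_cons p L κ
    have hletter : DependsOn (fun κ : α → Fin 3 => R.J (κ p)) {p} := fun κ κ' h => by simp [h]
    rw [List.toFinset_cons, actSet_insert t (by simpa using hp), hword,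
      act_mul_of_dependsOn_right t _ (R.dependsOn_word L) hp,
      actSet_mul_of_dependsOn_left t hletter (fun q hq => ?_), R.act_letter, ih hL]
    · funext κ
      simp only [Pi.add_apply, Pi.mul_apply, Ring.lie_def]
      noncomm_ring
    · rintro rfl
      exact hp (by simpa using hq)

theorem actSet_actSet_tr_word (t : Fin 3) {L Q : List α} (hL : (L ++ Q).Nodup) :
    actSet t L.toFinset (actSet t L.toFinset fun κ => R.tr (R.word (L ++ Q) κ)) =
      fun κ => R.tr (⁅R.J t, ⁅R.J t, R.word L κ⁆⁆ * R.word Q κ) := by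
  obtain ⟨hL, -, hdisj⟩ := List.nodup_append.1 hL
  have hQ : ∀ p ∈ L.toFinset, p ∉ {p | p ∈ Q} := fun p hp hpQ =>
    hdisj p (by simpa using hp) p hpQ rfl
  have hmul (F : (α → Fin 3) → A) :
      actSet t L.toFinset (fun κ => R.tr (F κ * R.word Q κ)) =
        fun κ => R.tr (actSet t L.toFinset F κ * R.word Q κ) := by
    have h := actSet_comp t L.toFinset R.tr (F * R.word Q)
    rwa [actSet_mul_of_dependsOn_right t F (R.dependsOn_word Q) hQ] at h
  have had : actSet t L.toFinset (fun κ => ⁅R.J t, R.word L κ⁆) =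
      fun κ => ⁅R.J t, ⁅R.J t, R.word L κ⁆⁆ := by
    have h := actSet_comp t L.toFinset
      (LinearMap.mulLeft ℂ (R.J t) - LinearMap.mulRight ℂ (R.J t)) (R.word L)
    simpa [Ring.lie_def, R.actSet_word t hL] using h
  simp only [R.word_append]
  rw [hmul, R.actSet_word t hL, hmul, had]

end Sl2Trace

/-! ### Chord diagrams and their invariant tensors -/

section ChordDelta

variable {α : Type*}

/-- The invariant tensor in `sl₂ ⊗ sl₂` carried by the two endpoints of a chord: in an orthonormal
basis its coordinates are Kronecker deltas. -/
noncomputable def chordDelta (c : Sym2 α) (κ : α → Fin 3) : ℂ :=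
  if (c.map κ).IsDiag then 1 else 0

theorem chordDelta_mk (p q : α) (κ : α → Fin 3) :
    chordDelta s(p, q) κ = if κ p = κ q then 1 else 0 := by
  simp [chordDelta]

theorem dependsOn_chordDelta (c : Sym2 α) : DependsOn (chordDelta c) {p | p ∈ c} := fun κ κ' h => by
  rw [chordDelta, chordDelta, Sym2.map_congr h]

variable [DecidableEq α]

theorem act_chordDelta (t : Fin 3) {p q : α} (h : p ≠ q) :
    act t p (chordDelta s(p, q)) = fun κ => structureConst t (κ p) (κ q) := by
  funext κ
  simp [act_apply, chordDelta_mk, Function.update_of_ne h.symm]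

theorem act_chordDelta_add_act_chordDelta (t : Fin 3) {p q : α} (h : p ≠ q) :
    act t p (chordDelta s(p, q)) + act t q (chordDelta s(p, q)) = 0 := by
  funext κ
  rw [act_chordDelta t h, Sym2.eq_swap, act_chordDelta t h.symm, Pi.add_apply,
    structureConst_swap_right, neg_add_cancel, Pi.zero_apply]

theorem sum_act_chordDelta_mul_act_chordDelta {p p' q q' : α} (hp : p ≠ p') (hq : q ≠ q') :
    ∑ t, act t p (chordDelta s(p, p')) * act t q (chordDelta s(q, q')) =
      chordDelta s(p, q') * chordDelta s(p', q) - chordDelta s(p, q) * chordDelta s(p', q') := by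
  funext κ
  simpa only [act_chordDelta _ hp, act_chordDelta _ hq, Finset.sum_apply, Pi.mul_apply,
    Pi.sub_apply, chordDelta_mk] using sum_structureConst_mul (κ p) (κ p') (κ q) (κ q')

end ChordDelta

theorem mem_points {D : Finset (Sym2 ℕ)} {p : ℕ} : p ∈ points D ↔ ∃ c ∈ D, p ∈ c := by
  simp [points]

theorem mem_points_insert {D : Finset (Sym2 ℕ)} {p q r : ℕ} :
    r ∈ points (insert s(p, q) D) ↔ r = p ∨ r = q ∨ r ∈ points D := by
  simp [mem_points, or_assoc]

/-- The chord `c` has two distinct endpoints, neither of which is a point of `D`, so that adding `c`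
to a chord diagram `D` gives a chord diagram. -/
def IsFresh (D : Finset (Sym2 ℕ)) (c : Sym2 ℕ) : Prop := ¬ c.IsDiag ∧ ∀ p ∈ c, p ∉ points D

theorem isFresh_mk {D : Finset (Sym2 ℕ)} {p q : ℕ} :
    IsFresh D s(p, q) ↔ p ≠ q ∧ p ∉ points D ∧ q ∉ points D := by
  simp [IsFresh]

theorem IsFresh.notMem {D : Finset (Sym2 ℕ)} {c : Sym2 ℕ} (hc : IsFresh D c) : c ∉ D := by
  induction c with
  | _ p q => exact fun h => hc.2 p (by simp) (mem_points.2 ⟨_, h, by simp⟩)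

theorem isChordDiagram_insert {D : Finset (Sym2 ℕ)} {c : Sym2 ℕ} (hc : c ∉ D) :
    IsChordDiagram (insert c D) ↔ IsFresh D c ∧ IsChordDiagram D := by
  simp only [IsChordDiagram, IsFresh, Finset.forall_mem_insert, mem_points, not_exists, not_and]
  constructor
  · rintro ⟨⟨hc', hdiag⟩, ⟨-, h⟩, hD⟩
    exact ⟨⟨hc', fun p hp d hd => h d hd (by grind) p hp⟩, hdiag, fun d hd => (hD d hd).2⟩
  · rintro ⟨⟨hc', h⟩, hdiag, hD⟩
    exact ⟨⟨hc', hdiag⟩, ⟨fun h => (h rfl).elim, fun d hd _ p hp => h p hp d hd⟩,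
      fun d hd => ⟨fun _ p hp hpc => h p hpc d hd hp, hD d hd⟩⟩

section IsChordDiagram

variable {D : Finset (Sym2 ℕ)} {c d : ℕ × ℕ}

theorem IsChordDiagram.isFresh_erase {a : Sym2 ℕ} (hD : IsChordDiagram D) (ha : a ∈ D) :
    IsFresh (D.erase a) a ∧ IsChordDiagram (D.erase a) := by
  rwa [← isChordDiagram_insert (Finset.notMem_erase a D), Finset.insert_erase ha]

theorem IsChordDiagram.ne {p q : ℕ} (hD : IsChordDiagram D) (h : s(p, q) ∈ D) : p ≠ q :=
  fun hpq => hD.1 _ h (Sym2.mk_isDiag_iff.2 hpq)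

theorem IsChordDiagram.eq_of_mem {p q r : ℕ} (hD : IsChordDiagram D) (hq : s(p, q) ∈ D)
    (hr : s(p, r) ∈ D) : q = r := by
  by_contra h
  exact hD.2 _ hq _ hr (by grind [Sym2.eq_iff]) p (by simp) (by simp)

theorem exists_mem_of_mem_points {p : ℕ} (hp : p ∈ points D) :
    ∃ q ∈ points D, s(p, q) ∈ D := by
  obtain ⟨c, hc, q, rfl⟩ := mem_points.1 hp
  exact ⟨q, mem_points.2 ⟨_, hc, by simp⟩, hc⟩

/-- Replace the chords `c = (p, p*)` and `d = (q, q*)` of `D` by `(p, q)` and `(p*, q*)`. -/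
def reconnect (D : Finset (Sym2 ℕ)) (c d : ℕ × ℕ) : Finset (Sym2 ℕ) :=
  insert s(c.1, d.1) (insert s(c.2, d.2) ((D.erase s(c.1, c.2)).erase s(d.1, d.2)))

theorem reconnectSame_eq_reconnect (D : Finset (Sym2 ℕ)) (a : Sym2 ℕ) (c d : ℕ × ℕ) :
    reconnectSame D a c d = reconnect (D.erase a) c d := rfl

theorem reconnectCross_eq_reconnect (D : Finset (Sym2 ℕ)) (a : Sym2 ℕ) (c d : ℕ × ℕ) :
    reconnectCross D a c d = reconnect (D.erase a) c d.swap := by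
  rw [reconnectCross, reconnect, Sym2.eq_swap (a := d.1) (b := c.2), Sym2.eq_swap (a := d.1)]
  rfl

variable (hD : IsChordDiagram D) (hc : s(c.1, c.2) ∈ D) (hd : s(d.1, d.2) ∈ D)
  (hcd : s(c.1, c.2) ≠ s(d.1, d.2))

include hc hd hcd in
theorem insert_insert_erase_erase :
    insert s(c.1, c.2) (insert s(d.1, d.2) ((D.erase s(c.1, c.2)).erase s(d.1, d.2))) = D := by
  rw [Finset.insert_erase (Finset.mem_erase.2 ⟨hcd.symm, hd⟩), Finset.insert_erase hc]

include hD hc hd hcd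

theorem isChordDiagram_erase_erase :
    IsChordDiagram ((D.erase s(c.1, c.2)).erase s(d.1, d.2)) :=
  ((hD.isFresh_erase hc).2.isFresh_erase (Finset.mem_erase.2 ⟨hcd.symm, hd⟩)).2

theorem isFresh_reconnect :
    IsFresh (insert s(c.2, d.2) ((D.erase s(c.1, c.2)).erase s(d.1, d.2))) s(c.1, d.1) ∧
      IsFresh ((D.erase s(c.1, c.2)).erase s(d.1, d.2)) s(c.2, d.2) := by
  have hd' : s(d.1, d.2) ∈ D.erase s(c.1, c.2) := Finset.mem_erase.2 ⟨hcd.symm, hd⟩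
  obtain ⟨hfc, hD'⟩ := hD.isFresh_erase hc
  obtain ⟨hfd, -⟩ := hD'.isFresh_erase hd'
  rw [← Finset.insert_erase hd', isFresh_mk, mem_points_insert, mem_points_insert] at hfc
  simp only [isFresh_mk, mem_points_insert] at hfd ⊢
  tauto

theorem IsChordDiagram.reconnect : IsChordDiagram (reconnect D c d) := by
  obtain ⟨h₁, h₂⟩ := isFresh_reconnect hD hc hd hcd
  exact (isChordDiagram_insert h₁.notMem).2
    ⟨h₁, (isChordDiagram_insert h₂.notMem).2 ⟨h₂, isChordDiagram_erase_erase hD hc hd hcd⟩⟩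

omit hD in
theorem points_reconnect : points (ChordWeight.reconnect D c d) = points D := by
  conv_rhs => rw [← insert_insert_erase_erase hc hd hcd]
  ext p
  simp only [ChordWeight.reconnect, mem_points_insert]
  tauto

theorem card_reconnect : (ChordWeight.reconnect D c d).card = D.card := by
  obtain ⟨h₁, h₂⟩ := isFresh_reconnect hD hc hd hcd
  have hd' : s(d.1, d.2) ∈ D.erase s(c.1, c.2) := Finset.mem_erase.2 ⟨hcd.symm, hd⟩
  rw [ChordWeight.reconnect, Finset.card_insert_of_notMem h₁.notMem,
    Finset.card_insert_of_notMem h₂.notMem, Finset.card_erase_add_one hd',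
    Finset.card_erase_add_one hc]

end IsChordDiagram

/-- The invariant tensor of a set of chords, one factor `sl₂` for each point. -/
noncomputable def diagramDelta (D : Finset (Sym2 ℕ)) : (ℕ → Fin 3) → ℂ := ∏ c ∈ D, chordDelta c

theorem diagramDelta_insert {D : Finset (Sym2 ℕ)} {c : Sym2 ℕ} (hc : c ∉ D) :
    diagramDelta (insert c D) = chordDelta c * diagramDelta D :=
  Finset.prod_insert hc

theorem dependsOn_diagramDelta (D : Finset (Sym2 ℕ)) : DependsOn (diagramDelta D) (points D) :=
  fun κ κ' h => by
    simp only [diagramDelta, Finset.prod_apply]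
    exact Finset.prod_congr rfl fun c hc =>
      dependsOn_chordDelta c fun p hp => h p (mem_points.2 ⟨c, hc, hp⟩)

theorem act_diagramDelta (t : Fin 3) {D : Finset (Sym2 ℕ)} (hD : IsChordDiagram D) {c : Sym2 ℕ}
    (hc : c ∈ D) {p : ℕ} (hp : p ∈ c) :
    act t p (diagramDelta D) = act t p (chordDelta c) * diagramDelta (D.erase c) := by
  conv_lhs => rw [← Finset.insert_erase hc, diagramDelta_insert (Finset.notMem_erase c D)]
  exact act_mul_of_dependsOn_right t _ (dependsOn_diagramDelta _) ((hD.isFresh_erase hc).1.2 p hp)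

theorem act_diagramDelta_add_act_diagramDelta (t : Fin 3) {D : Finset (Sym2 ℕ)}
    (hD : IsChordDiagram D) {p q : ℕ} (h : s(p, q) ∈ D) :
    act t p (diagramDelta D) + act t q (diagramDelta D) = 0 := by
  rw [act_diagramDelta t hD h (by simp), act_diagramDelta t hD h (by simp), ← add_mul,
    act_chordDelta_add_act_chordDelta t (hD.ne h), zero_mul]

section Reconnect

variable {D : Finset (Sym2 ℕ)} {c d : ℕ × ℕ} (hD : IsChordDiagram D) (hc : s(c.1, c.2) ∈ D)
  (hd : s(d.1, d.2) ∈ D) (hcd : s(c.1, c.2) ≠ s(d.1, d.2))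

include hD hc hd hcd

theorem diagramDelta_reconnect :
    diagramDelta (reconnect D c d) = chordDelta s(c.1, d.1) * chordDelta s(c.2, d.2) *
      diagramDelta ((D.erase s(c.1, c.2)).erase s(d.1, d.2)) := by
  obtain ⟨h₁, h₂⟩ := isFresh_reconnect hD hc hd hcd
  rw [reconnect, diagramDelta_insert h₁.notMem, diagramDelta_insert h₂.notMem, mul_assoc]

theorem diagramDelta_reconnect_swap :
    diagramDelta (reconnect D c d.swap) = chordDelta s(c.1, d.2) * chordDelta s(c.2, d.1) *
      diagramDelta ((D.erase s(c.1, c.2)).erase s(d.1, d.2)) := by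
  have hswap : s(d.1, d.2) = s(d.swap.1, d.swap.2) := Sym2.eq_swap
  rw [hswap] at hd hcd ⊢
  exact diagramDelta_reconnect hD hc hd hcd

theorem sum_act_act_diagramDelta :
    ∑ t, act t c.1 (act t d.1 (diagramDelta D)) =
      diagramDelta (reconnect D c d.swap) - diagramDelta (reconnect D c d) := by
  have hc' : s(c.1, c.2) ∈ D.erase s(d.1, d.2) := Finset.mem_erase.2 ⟨hcd, hc⟩
  obtain ⟨hfd, hD'⟩ := hD.isFresh_erase hd
  have hcd' : c.1 ∉ {p | p ∈ s(d.1, d.2)} := fun h =>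
    hfd.2 c.1 h (mem_points.2 ⟨_, hc', by simp⟩)
  have hdep (t : Fin 3) : DependsOn (act t d.1 (chordDelta s(d.1, d.2))) {p | p ∈ s(d.1, d.2)} := by
    rw [act_chordDelta t (hD.ne hd)]
    exact fun κ κ' h => congrArg₂ (structureConst t) (h d.1 (by simp)) (h d.2 (by simp))
  calc ∑ t, act t c.1 (act t d.1 (diagramDelta D))
      = ∑ t, act t c.1 (chordDelta s(c.1, c.2)) * act t d.1 (chordDelta s(d.1, d.2)) *
          diagramDelta ((D.erase s(d.1, d.2)).erase s(c.1, c.2)) := by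
        refine Finset.sum_congr rfl fun t _ => ?_
        rw [act_diagramDelta t hD hd (by simp), act_mul_of_dependsOn_left t (hdep t) hcd',
          act_diagramDelta t hD' hc' (by simp)]
        ring
    _ = _ := by
        rw [← Finset.sum_mul, sum_act_chordDelta_mul_act_chordDelta (hD.ne hc) (hD.ne hd),
          diagramDelta_reconnect hD hc hd hcd, diagramDelta_reconnect_swap hD hc hd hcd,
          Finset.erase_right_comm]
        ring

end Reconnect

/-! ### The chords leaving a set of points -/

theorem sum_sum_eq_sum_diag_add {ι κ M : Type*} [LinearOrder κ] [AddCommMonoid M] (s : Finset ι)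
    {k : ι → κ} (hk : Set.InjOn k s) {F : ι → ι → M} (hF : ∀ i ∈ s, ∀ j ∈ s, F i j = F j i) :
    ∑ i ∈ s, ∑ j ∈ s, F i j =
      ∑ i ∈ s, F i i + 2 • ∑ ij ∈ (s ×ˢ s).filter (fun ij => k ij.1 < k ij.2), F ij.1 ij.2 := by
  classical
  have hgt : ∑ ij ∈ (s ×ˢ s).filter (fun ij => k ij.2 < k ij.1), F ij.1 ij.2 =
      ∑ ij ∈ (s ×ˢ s).filter (fun ij => k ij.1 < k ij.2), F ij.1 ij.2 :=
    Finset.sum_nbij' Prod.swap Prod.swap (by simp +contextual) (by simp +contextual) (by simp)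
      (by simp) (by simp +contextual [hF])
  have hsplit (i : ι) (hi : i ∈ s) (j : ι) (hj : j ∈ s) : F i j =
      (if i = j then F i j else 0) + ((if k i < k j then F i j else 0) +
        if k j < k i then F i j else 0) := by
    rcases lt_trichotomy (k i) (k j) with h | h | h
    · simp [h, h.not_gt, ne_of_apply_ne k h.ne]
    · simp [hk hi hj h]
    · simp [h, h.not_gt, ne_of_apply_ne k h.ne']
  have hdiag : ∑ i ∈ s, ∑ j ∈ s, (if i = j then F i j else 0) = ∑ i ∈ s, F i i :=
    Finset.sum_congr rfl fun i hi => by rw [Finset.sum_ite_eq, if_pos hi]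
  rw [Finset.sum_congr rfl fun i hi => Finset.sum_congr rfl (hsplit i hi)]
  simp only [Finset.sum_add_distrib, hdiag]
  rw [two_smul]
  nth_rewrite 2 [← hgt]
  simp only [Finset.sum_filter, Finset.sum_product]

/-- The chords of `D` with exactly one endpoint in `S`, each written as a pair whose first entry is
that endpoint. -/
def outgoing (D : Finset (Sym2 ℕ)) (S : Finset ℕ) : Finset (ℕ × ℕ) :=
  (S ×ˢ (points D \ S)).filter fun c => s(c.1, c.2) ∈ D

theorem mem_outgoing {D : Finset (Sym2 ℕ)} {S : Finset ℕ} {c : ℕ × ℕ} :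
    c ∈ outgoing D S ↔ c.1 ∈ S ∧ c.2 ∉ S ∧ s(c.1, c.2) ∈ D := by
  have (h : s(c.1, c.2) ∈ D) : c.2 ∈ points D := mem_points.2 ⟨_, h, by simp⟩
  simp only [outgoing, Finset.mem_filter, Finset.mem_product, Finset.mem_sdiff]
  tauto

section Outgoing

variable {D : Finset (Sym2 ℕ)} {S : Finset ℕ} (hD : IsChordDiagram D)

include hD

theorem injOn_fst_outgoing : Set.InjOn Prod.fst (outgoing D S : Set (ℕ × ℕ)) := by
  rintro ⟨p, q⟩ hc ⟨p', q'⟩ hd rfl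
  exact Prod.ext rfl (hD.eq_of_mem (mem_outgoing.1 hc).2.2 (mem_outgoing.1 hd).2.2)

theorem sum_eq_sum_outgoing {M : Type*} [AddCommGroup M] (hS : S ⊆ points D) {g : ℕ → M}
    (hg : ∀ p q, s(p, q) ∈ D → g p + g q = 0) :
    ∑ p ∈ S, g p = ∑ c ∈ outgoing D S, g c.1 := by
  have hinner : ∑ c ∈ (S ×ˢ S).filter (fun c => s(c.1, c.2) ∈ D), g c.1 = 0 :=
    Finset.sum_involution (fun c _ => c.swap)
      (fun c hc => hg _ _ (Finset.mem_filter.1 hc).2)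
      (fun c hc _ h => hD.ne (Finset.mem_filter.1 hc).2 (congrArg Prod.snd h))
      (fun c hc => by simpa [Sym2.eq_swap, and_comm] using hc) (fun c _ => c.swap_swap)
  have hpartner (p : ℕ) (hp : p ∈ S) : ∑ q ∈ points D, (if s(p, q) ∈ D then g p else 0) = g p := by
    obtain ⟨q, hq, hpq⟩ := exists_mem_of_mem_points (hS hp)
    rw [Finset.sum_eq_single_of_mem q hq fun r _ hr =>
      if_neg fun h => hr (hD.eq_of_mem h hpq), if_pos hpq]
  calc ∑ p ∈ S, g p
      = ∑ p ∈ S, ∑ q ∈ points D, (if s(p, q) ∈ D then g p else 0) :=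
        (Finset.sum_congr rfl hpartner).symm
    _ = ∑ c ∈ outgoing D S, g c.1 +
          ∑ c ∈ (S ×ˢ S).filter (fun c => s(c.1, c.2) ∈ D), g c.1 := by
        simp only [outgoing, Finset.sum_filter, Finset.sum_product, ← Finset.sum_add_distrib,
          Finset.sum_sdiff hS]
    _ = ∑ c ∈ outgoing D S, g c.1 := by rw [hinner, add_zero]

theorem sum_actSet_actSet_diagramDelta (hS : S ⊆ points D) :
    ∑ t, actSet t S (actSet t S (diagramDelta D)) =
      (2 : ℂ) • (((outgoing D S).card : ℂ) • diagramDelta D +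
        ∑ cd ∈ (outgoing D S ×ˢ outgoing D S).filter (fun cd => cd.1.1 < cd.2.1),
          (diagramDelta (reconnect D cd.1 cd.2.swap) - diagramDelta (reconnect D cd.1 cd.2))) := by
  have hact (t : Fin 3) : actSet t S (diagramDelta D) =
      ∑ c ∈ outgoing D S, act t c.1 (diagramDelta D) := by
    rw [actSet_apply]
    exact sum_eq_sum_outgoing hD hS fun p q h => act_diagramDelta_add_act_diagramDelta t hD h
  have hcomm (t : Fin 3) (p q : ℕ) (F : (ℕ → Fin 3) → ℂ) :
      act t p (act t q F) = act t q (act t p F) := by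
    rcases eq_or_ne p q with rfl | h
    exacts [rfl, act_comm h t t F]
  have hsq (t : Fin 3) : actSet t S (actSet t S (diagramDelta D)) =
      ∑ c ∈ outgoing D S, ∑ d ∈ outgoing D S, act t c.1 (act t d.1 (diagramDelta D)) := by
    conv_lhs => rw [hact, map_sum]
    refine Finset.sum_congr rfl fun c _ => ?_
    rw [actSet_apply, Finset.sum_congr rfl fun p _ => hcomm t p c.1 _, ← map_sum, ← actSet_apply,
      hact, map_sum]
  simp only [hsq]
  rw [Finset.sum_comm]
  simp only [Finset.sum_comm (s := Finset.univ) (t := outgoing D S)]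
  rw [sum_sum_eq_sum_diag_add (outgoing D S) (injOn_fst_outgoing hD)
    fun c _ d _ => Finset.sum_congr rfl fun t _ => hcomm t c.1 d.1 _]
  have hoff : ∀ cd ∈ (outgoing D S ×ˢ outgoing D S).filter (fun cd => cd.1.1 < cd.2.1),
      ∑ t, act t cd.1.1 (act t cd.2.1 (diagramDelta D)) =
        diagramDelta (reconnect D cd.1 cd.2.swap) - diagramDelta (reconnect D cd.1 cd.2) := by
    simp only [Finset.mem_filter, Finset.mem_product, mem_outgoing, and_imp]
    intro cd hc₁ _ hc _ hd₂ hd hlt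
    refine sum_act_act_diagramDelta hD hc hd fun h => ?_
    rcases Sym2.eq_iff.1 h with h | h
    exacts [hlt.ne h.1, hd₂ (h.1 ▸ hc₁)]
  rw [Finset.sum_congr rfl hoff]
  simp only [sum_act_act_self, Finset.sum_const]
  module

end Outgoing

/-! ### The weight system of a representation -/

namespace Sl2Trace

variable {A : Type*} [Ring A] [Algebra ℂ A] (R : Sl2Trace A)

/-- The trace of the word read along `L`, contracted with the invariant tensor of `D`. -/
noncomputable def val (L : List ℕ) (D : Finset (Sym2 ℕ)) : ℂ :=
  colorSum L.toFinset (diagramDelta D * fun κ => R.tr (R.word L κ)) 0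

theorem val_append_comm (L L' : List ℕ) (D : Finset (Sym2 ℕ)) :
    R.val (L ++ L') D = R.val (L' ++ L) D := by
  simp only [val, List.toFinset_append, Finset.union_comm, word_append, R.tr_mul_comm]

theorem val_insert {p q : ℕ} {L Q : List ℕ} {D : Finset (Sym2 ℕ)} (hL : (p :: L ++ q :: Q).Nodup)
    (hD : points D = (L ++ Q).toFinset) :
    R.val (p :: L ++ q :: Q) (insert s(p, q) D) =
      colorSum (L ++ Q).toFinset
        (diagramDelta D * fun κ => ∑ t, R.tr (R.J t * R.word L κ * R.J t * R.word Q κ)) 0 := by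
  obtain ⟨hpq, ⟨hpL, hpQ⟩, hqL, hqQ⟩ : p ≠ q ∧ (p ∉ L ∧ p ∉ Q) ∧ q ∉ L ∧ q ∉ Q := by grind
  have hp : p ∉ points D := by simp [hD, hpL, hpQ]
  have hq : q ∉ points D := by simp [hD, hqL, hqQ]
  have hset : (p :: L ++ q :: Q).toFinset = insert p (insert q (points D)) := by
    ext r
    simp only [hD, List.mem_toFinset, List.mem_append, List.mem_cons, Finset.mem_insert]
    tauto
  have hcolor : colorSumAt q (colorSumAt p
      (chordDelta s(p, q) * fun κ => R.tr (R.word (p :: L ++ q :: Q) κ))) =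
        fun κ => ∑ t, R.tr (R.J t * R.word L κ * R.J t * R.word Q κ) := by
    funext κ
    simp [colorSumAt_apply, chordDelta_mk, word_append, word_cons, R.word_update, hpL, hpQ, hqL,
      hqQ, Function.update_of_ne hpq.symm, mul_assoc]
  rw [val, hset, colorSum_insert (by simp [hpq, hp]), colorSum_insert hq,
    diagramDelta_insert (isFresh_mk.2 ⟨hpq, hp, hq⟩).notMem, mul_comm (chordDelta _), mul_assoc,
    colorSumAt_mul_of_dependsOn (dependsOn_diagramDelta D) (by simpa using hp),
    colorSumAt_mul_of_dependsOn (dependsOn_diagramDelta D) (by simpa using hq), hcolor, hD]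

/-- Invariance of the contraction moves the double commutator onto the invariant tensor of the
diagram. -/
theorem sum_colorSum_mul_double_commutator {L Q : List ℕ} {D : Finset (Sym2 ℕ)}
    (hL : (L ++ Q).Nodup) :
    ∑ t, colorSum (L ++ Q).toFinset
        (diagramDelta D * fun κ => R.tr (⁅R.J t, ⁅R.J t, R.word L κ⁆⁆ * R.word Q κ)) 0 =
      colorSum (L ++ Q).toFinset
        ((∑ t, actSet t L.toFinset (actSet t L.toFinset (diagramDelta D))) *
          fun κ => R.tr (R.word (L ++ Q) κ)) 0 := by
  have hsub : L.toFinset ⊆ (L ++ Q).toFinset := by simp [List.toFinset_append]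
  rw [Finset.sum_mul, map_sum, Finset.sum_apply]
  refine Finset.sum_congr rfl fun t _ => ?_
  rw [← R.actSet_actSet_tr_word t hL, colorSum_mul_actSet t hsub, colorSum_mul_actSet t hsub,
    neg_neg]

theorem val_recursion {p q : ℕ} {L Q : List ℕ} {D : Finset (Sym2 ℕ)} (hD : IsChordDiagram D)
    (hL : (p :: L ++ q :: Q).Nodup) (hpts : points D = (L ++ Q).toFinset) :
    R.val (p :: L ++ q :: Q) (insert s(p, q) D) =
      (R.x - (outgoing D L.toFinset).card) * R.val (L ++ Q) D +
        ∑ cd ∈ (outgoing D L.toFinset ×ˢ outgoing D L.toFinset).filter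
            (fun cd => cd.1.1 < cd.2.1),
          (R.val (L ++ Q) (reconnect D cd.1 cd.2) -
            R.val (L ++ Q) (reconnect D cd.1 cd.2.swap)) := by
  have hLQ : (L ++ Q).Nodup := by grind
  have hsub : L.toFinset ⊆ points D := by simp [hpts, List.toFinset_append]
  have hsplit : (diagramDelta D * fun κ => ∑ t, R.tr (R.J t * R.word L κ * R.J t * R.word Q κ)) =
      R.x • (diagramDelta D * fun κ => R.tr (R.word (L ++ Q) κ)) - (1 / 2 : ℂ) •
        ∑ t, diagramDelta D * fun κ => R.tr (⁅R.J t, ⁅R.J t, R.word L κ⁆⁆ * R.word Q κ) := by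
    funext κ
    simp only [Pi.mul_apply, Pi.sub_apply, Pi.smul_apply, Finset.sum_apply,
      R.sum_tr_J_mul_mul_J_mul, word_append, smul_eq_mul, ← Finset.mul_sum]
    ring
  rw [R.val_insert hL hpts, hsplit, map_sub, map_smul, map_smul, map_sum, Pi.sub_apply,
    Pi.smul_apply, Pi.smul_apply, Finset.sum_apply, R.sum_colorSum_mul_double_commutator hLQ,
    sum_actSet_actSet_diagramDelta hD hsub, smul_mul_assoc, add_mul, smul_mul_assoc,
    Finset.sum_mul]
  have hval (D' : Finset (Sym2 ℕ)) : colorSum (L ++ Q).toFinset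
      (diagramDelta D' * fun κ => R.tr (R.word (L ++ Q) κ)) 0 = R.val (L ++ Q) D' := rfl
  simp only [sub_mul, map_smul, map_add, map_sum, map_sub, Pi.smul_apply, Pi.add_apply,
    Finset.sum_apply, Pi.sub_apply, hval, smul_eq_mul, Finset.sum_sub_distrib]
  ring

/-- The weight of `D` in the weight system of `R`: the points are read in increasing order. -/
noncomputable def diagramVal (D : Finset (Sym2 ℕ)) : ℂ := R.val ((points D).sort (· ≤ ·)) D

end Sl2Trace

section Crossing

variable {D : Finset (Sym2 ℕ)} {a : Sym2 ℕ}

/-- The points of `D` strictly between the endpoints of `a`. -/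
def between (D : Finset (Sym2 ℕ)) (a : Sym2 ℕ) : Finset ℕ :=
  (points D).filter fun p => a.inf < p ∧ p < a.sup

theorem mem_iff_eq_inf_or_eq_sup {p : ℕ} : p ∈ a ↔ p = a.inf ∨ p = a.sup := by
  induction a with
  | _ q r => simp only [Sym2.mem_iff, Sym2.inf_mk, Sym2.sup_mk]; grind

theorem mk_inf_sup (a : Sym2 ℕ) : s(a.inf, a.sup) = a :=
  Sym2.sortEquiv.symm_apply_apply a

theorem crossing_eq_outgoing (hD : IsChordDiagram D) (ha : a ∈ D) :
    crossing D a = outgoing (D.erase a) (between D a) := by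
  ext ⟨p, q⟩
  obtain ⟨ha', -⟩ := hD.isFresh_erase ha
  have hpq (h : s(p, q) ∈ D.erase a) : q ≠ a.inf ∧ q ≠ a.sup := by
    have hq : q ∉ a := fun hq => ha'.2 q hq (mem_points.2 ⟨_, h, by simp⟩)
    rwa [mem_iff_eq_inf_or_eq_sup, not_or] at hq
  have hp (h : s(p, q) ∈ D) : p ∈ points D ∧ q ∈ points D :=
    ⟨mem_points.2 ⟨_, h, by simp⟩, mem_points.2 ⟨_, h, by simp⟩⟩
  have hne (h : s(p, q) = a) : p = a.inf ∨ p = a.sup :=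
    mem_iff_eq_inf_or_eq_sup.1 (h ▸ Sym2.mem_mk_left p q)
  simp only [crossing, mem_outgoing, between, Finset.mem_filter, Finset.mem_product,
    Finset.mem_erase, ne_eq] at hpq ⊢
  grind

end Crossing

section SortDecomposition

variable {α : Type*} [LinearOrder α] {S : Finset α} {p q : α}

theorem sort_eq_append_cons_append_cons (hp : p ∈ S) (hq : q ∈ S) (hpq : p < q) :
    S.sort (· ≤ ·) = (S.filter (· < p)).sort (· ≤ ·) ++
      (p :: (S.filter fun r => p < r ∧ r < q).sort (· ≤ ·) ++
        q :: (S.filter (q < ·)).sort (· ≤ ·)) := by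
  refine (Finset.sortedLT_sort S).eq_of_mem_iff (List.Pairwise.sortedLT ?_) fun r => ?_
  · simp only [List.cons_append, List.pairwise_append, List.pairwise_cons,
      (Finset.sortedLT_sort _).pairwise, Finset.mem_sort, Finset.mem_filter, List.mem_append,
      List.mem_cons]
    grind
  · simp only [Finset.mem_sort, List.mem_append, List.mem_cons, Finset.mem_filter]
    grind

theorem sort_filter_ne_eq_append_append (hpq : p < q) :
    (S.filter fun r => r ≠ p ∧ r ≠ q).sort (· ≤ ·) = (S.filter (· < p)).sort (· ≤ ·) ++
      ((S.filter fun r => p < r ∧ r < q).sort (· ≤ ·) ++ (S.filter (q < ·)).sort (· ≤ ·)) := by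
  refine (Finset.sortedLT_sort _).eq_of_mem_iff (List.Pairwise.sortedLT ?_) fun r => ?_
  · simp only [List.pairwise_append, (Finset.sortedLT_sort _).pairwise, Finset.mem_sort,
      Finset.mem_filter, List.mem_append]
    grind
  · simp only [Finset.mem_sort, List.mem_append, Finset.mem_filter]
    grind

end SortDecomposition

section Erase

variable {D : Finset (Sym2 ℕ)} {a : Sym2 ℕ} (hD : IsChordDiagram D) (ha : a ∈ D)

include hD ha

theorem inf_lt_sup : a.inf < a.sup := by
  induction a with
  | _ p q => simpa [eq_comm] using hD.ne ha

theorem points_erase :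
    points (D.erase a) = (points D).filter fun r => r ≠ a.inf ∧ r ≠ a.sup := by
  obtain ⟨hfresh, -⟩ := hD.isFresh_erase ha
  ext r
  rw [Finset.mem_filter]
  conv_rhs => rw [← Finset.insert_erase ha]
  have hr : r ∈ points (insert a (D.erase a)) ↔ r ∈ a ∨ r ∈ points (D.erase a) := by
    simp [mem_points]
  have hra := hfresh.2 r
  rw [hr, ← not_or, ← mem_iff_eq_inf_or_eq_sup]
  tauto

omit ha in
theorem isChordDiagram_points_card_reconnect {c d : ℕ × ℕ} (hc : s(c.1, c.2) ∈ D)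
    (hd : s(d.1, d.2) ∈ D) (hcd : s(c.1, c.2) ≠ s(d.1, d.2)) {E : Finset (Sym2 ℕ)}
    (hE : E = reconnect D c d ∨ E = reconnect D c d.swap) :
    IsChordDiagram E ∧ points E = points D ∧ E.card = D.card := by
  have hswap : s(d.1, d.2) = s(d.swap.1, d.swap.2) := Sym2.eq_swap
  rcases hE with rfl | rfl
  · exact ⟨hD.reconnect hc hd hcd, points_reconnect hc hd hcd, card_reconnect hD hc hd hcd⟩
  · rw [hswap] at hd hcd
    exact ⟨hD.reconnect hc hd hcd, points_reconnect hc hd hcd, card_reconnect hD hc hd hcd⟩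

theorem isChordDiagram_points_card_of_mem_crossing {cd : (ℕ × ℕ) × (ℕ × ℕ)}
    (hcd : cd ∈ (crossing D a ×ˢ crossing D a).filter fun cd => cd.1.1 < cd.2.1)
    {E : Finset (Sym2 ℕ)}
    (hE : E = reconnectSame D a cd.1 cd.2 ∨ E = reconnectCross D a cd.1 cd.2) :
    IsChordDiagram E ∧ points E = points (D.erase a) ∧ E.card = (D.erase a).card := by
  rw [reconnectSame_eq_reconnect, reconnectCross_eq_reconnect] at hE
  simp only [crossing_eq_outgoing hD ha, Finset.mem_filter, Finset.mem_product, mem_outgoing] at hcd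
  obtain ⟨⟨⟨hc₁, -, hc⟩, -, hd₂, hd⟩, hlt⟩ := hcd
  refine isChordDiagram_points_card_reconnect (hD.isFresh_erase ha).2 hc hd (fun h => ?_) hE
  rcases Sym2.eq_iff.1 h with h | h
  exacts [hlt.ne h.1, hd₂ (h.1 ▸ hc₁)]

end Erase

namespace Sl2Trace

variable {A : Type*} [Ring A] [Algebra ℂ A] (R : Sl2Trace A)

theorem diagramVal_recursion {D : Finset (Sym2 ℕ)} (hD : IsChordDiagram D) {a : Sym2 ℕ}
    (ha : a ∈ D) :
    R.diagramVal D = (R.x - (crossing D a).card) * R.diagramVal (D.erase a) +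
      ∑ cd ∈ (crossing D a ×ˢ crossing D a).filter (fun cd => cd.1.1 < cd.2.1),
        (R.diagramVal (reconnectSame D a cd.1 cd.2) -
          R.diagramVal (reconnectCross D a cd.1 cd.2)) := by
  obtain ⟨-, hD'⟩ := hD.isFresh_erase ha
  have hlt := inf_lt_sup hD ha
  have hinf : a.inf ∈ points D := mem_points.2 ⟨a, ha, mem_iff_eq_inf_or_eq_sup.2 (.inl rfl)⟩
  have hsup : a.sup ∈ points D := mem_points.2 ⟨a, ha, mem_iff_eq_inf_or_eq_sup.2 (.inr rfl)⟩
  have hsort := sort_eq_append_cons_append_cons hinf hsup hlt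
  have hsort' := points_erase hD ha ▸ sort_filter_ne_eq_append_append (S := points D) hlt
  rw [← between] at hsort hsort'
  generalize hL : (between D a).sort (· ≤ ·) = L at hsort hsort'
  generalize ((points D).filter (· < a.inf)).sort (· ≤ ·) = P at hsort hsort'
  generalize ((points D).filter (a.sup < ·)).sort (· ≤ ·) = Q at hsort hsort'
  have hbetween : L.toFinset = between D a := by rw [← hL, Finset.sort_toFinset]
  have hval {E : Finset (Sym2 ℕ)} (h : points E = points (D.erase a)) :
      R.diagramVal E = R.val (L ++ (Q ++ P)) E := by
    rw [diagramVal, h, hsort', val_append_comm, List.append_assoc]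
  have hpts : points (D.erase a) = (L ++ (Q ++ P)).toFinset := by
    rw [← (points (D.erase a)).sort_toFinset (· ≤ ·), hsort']
    simp only [List.toFinset_append, Finset.union_comm, Finset.union_left_comm]
  have hnodup : (a.inf :: L ++ a.sup :: (Q ++ P)).Nodup := by
    have h := (points D).sort_nodup (· ≤ ·)
    rw [hsort, List.nodup_append_comm] at h
    simpa using h
  have hrec := R.val_recursion hD' hnodup hpts
  rw [hbetween, ← crossing_eq_outgoing hD ha, mk_inf_sup, Finset.insert_erase ha] at hrec
  rw [diagramVal, hsort, val_append_comm, List.append_assoc, List.cons_append, hval rfl]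
  refine hrec.trans (congrArg _ (Finset.sum_congr rfl fun cd hcd => ?_))
  rw [hval (isChordDiagram_points_card_of_mem_crossing hD ha hcd (.inl rfl)).2.1,
    hval (isChordDiagram_points_card_of_mem_crossing hD ha hcd (.inr rfl)).2.1,
    reconnectCross_eq_reconnect]
  rfl

theorem aeval_recursionRHS {φ : Finset (Sym2 ℕ) → ℤ[X]} {D : Finset (Sym2 ℕ)}
    (hD : IsChordDiagram D) {a : Sym2 ℕ} (ha : a ∈ D)
    (hφ : ∀ E, IsChordDiagram E → E.card + 1 = D.card → aeval R.x (φ E) = R.diagramVal E) :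
    aeval R.x (recursionRHS φ D a) = R.diagramVal D := by
  have hcard := Finset.card_erase_add_one ha
  rw [R.diagramVal_recursion hD ha]
  simp only [recursionRHS, map_add, map_mul, map_sub, aeval_X, map_natCast, map_sum]
  rw [hφ _ (hD.isFresh_erase ha).2 hcard]
  refine congrArg _ (Finset.sum_congr rfl fun cd hcd => ?_)
  obtain ⟨hsame, -, hsame'⟩ := isChordDiagram_points_card_of_mem_crossing hD ha hcd (.inl rfl)
  obtain ⟨hcross, -, hcross'⟩ := isChordDiagram_points_card_of_mem_crossing hD ha hcd (.inr rfl)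
  rw [hφ _ hsame (by rw [hsame', hcard]), hφ _ hcross (by rw [hcross', hcard])]

theorem diagramVal_empty : R.diagramVal ∅ = 1 := by
  simp [diagramVal, val, points, diagramDelta, R.tr_one]

theorem aeval_weight {D : Finset (Sym2 ℕ)} (hD : IsChordDiagram D) :
    aeval R.x (weight D) = R.diagramVal D := by
  unfold weight
  generalize hn : D.card = n
  induction n generalizing D with
  | zero =>
    rw [Finset.card_eq_zero.1 hn, diagramVal_empty, weightAux, map_one]
  | succ n ih =>
    have hne : D.Nonempty := Finset.card_pos.1 (hn ▸ n.succ_pos)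
    rw [weightAux, dif_pos hne]
    exact R.aeval_recursionRHS hD hne.choose_spec fun E hE hcard => ih hE (by omega)

end Sl2Trace

/-! ### Invariance under relabelling -/

theorem pairwise_cyclicallyOrdered {S T : List ℕ} {m : ℕ} (h : (S ++ m :: T).Pairwise (· < ·)) :
    (T ++ S).Pairwise (CyclicallyOrdered m) := by
  simp only [List.pairwise_append, List.pairwise_cons, List.mem_cons, forall_eq_or_imp] at h ⊢
  obtain ⟨hS, ⟨hmT, hT⟩, hST⟩ := h
  exact ⟨hT.imp_of_mem fun hp _ hpq => .inl ⟨hmT _ hp, hpq⟩,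
    hS.imp_of_mem fun _ hq hpq => .inr (.inl ⟨hpq, (hST _ hq).1⟩),
    fun p hp q hq => .inr (.inr ⟨(hST q hq).1, hmT p hp⟩)⟩

theorem lt_of_cyclicallyOrdered {m p q : ℕ} (hp : m < p) (hq : m < q)
    (h : CyclicallyOrdered m p q) : p < q := by
  unfold CyclicallyOrdered at h
  lia

theorem map_isRotated_of_cyclicallyOrdered {f : ℕ → ℕ} {L L' : List ℕ} (hL : L.SortedLT)
    (hL' : L'.SortedLT) (hf : Set.InjOn f {p | p ∈ L}) (hmem : ∀ r, r ∈ L' ↔ r ∈ L.map f)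
    (hcyc : ∀ p ∈ L, ∀ q ∈ L, ∀ r ∈ L, CyclicallyOrdered p q r →
      CyclicallyOrdered (f p) (f q) (f r)) : L.map f ~r L' := by
  rcases eq_or_ne L [] with rfl | hne
  · have hL'_nil : L' = [] := List.eq_nil_iff_forall_not_mem.2 fun r hr => by
      simpa using (hmem r).1 hr
    rw [hL'_nil, List.map_nil]
  obtain ⟨m, hm, hmin⟩ :=
    Finset.exists_min_image L.toFinset f ((List.toFinset_nonempty_iff L).2 hne)
  obtain ⟨S, T, rfl⟩ := List.append_of_mem (List.mem_toFinset.1 hm)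
  have hrot : S ++ m :: T ~r m :: (T ++ S) := List.isRotated_append
  have hmem' (q : ℕ) : q ∈ S ++ m :: T ↔ q ∈ m :: (T ++ S) := hrot.mem_iff
  have hmin' : ∀ q ∈ T ++ S, f m < f q := by
    intro q hq
    have hq' : q ∈ S ++ m :: T := (hmem' q).2 (List.mem_cons_of_mem _ hq)
    refine (hmin q (List.mem_toFinset.2 hq')).lt_of_ne fun h => ?_
    rw [← hf (by simp) hq' h] at hq
    exact (List.nodup_cons.1 (hrot.nodup_iff.1 hL.nodup)).1 hq
  have hsorted : ((m :: (T ++ S)).map f).SortedLT := by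
    rw [List.sortedLT_iff_pairwise, List.pairwise_map, List.pairwise_cons]
    refine ⟨hmin', (pairwise_cyclicallyOrdered hL.pairwise).imp_of_mem fun {p q} hp hq h => ?_⟩
    exact lt_of_cyclicallyOrdered (hmin' p hp) (hmin' q hq) <|
      hcyc m (by simp) p ((hmem' p).2 (List.mem_cons_of_mem _ hp)) q
        ((hmem' q).2 (List.mem_cons_of_mem _ hq)) h
  rw [← hsorted.eq_of_mem_iff hL' fun r => by rw [hmem, (hrot.map f).mem_iff]]
  exact hrot.map f

theorem points_image (f : ℕ → ℕ) (D : Finset (Sym2 ℕ)) :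
    points (D.image (Sym2.map f)) = (points D).image f := by
  ext r
  simp only [mem_points, Finset.mem_image, exists_exists_and_eq_and, Sym2.mem_map]
  tauto

theorem injOn_sym2Map {f : ℕ → ℕ} {D : Finset (Sym2 ℕ)} (hf : Set.InjOn f (points D)) :
    Set.InjOn (Sym2.map f) D := by
  intro c hc d hd hcd
  induction c with | _ p q =>
  induction d with | _ p' q' =>
  have hmem {c : Sym2 ℕ} (hc : c ∈ D) {p : ℕ} (hp : p ∈ c) : p ∈ (points D : Set ℕ) :=
    mem_points.2 ⟨c, hc, hp⟩
  have hp := hmem hc (Sym2.mem_mk_left p q)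
  have hq := hmem hc (Sym2.mem_mk_right p q)
  have hp' := hmem hd (Sym2.mem_mk_left p' q')
  have hq' := hmem hd (Sym2.mem_mk_right p' q')
  simpa only [Sym2.map_mk, Sym2.eq_iff, hf.eq_iff hp hp', hf.eq_iff hp hq', hf.eq_iff hq hp',
    hf.eq_iff hq hq'] using hcd

theorem diagramDelta_image {f : ℕ → ℕ} {D : Finset (Sym2 ℕ)} (hf : Set.InjOn f (points D))
    (κ : ℕ → Fin 3) : diagramDelta (D.image (Sym2.map f)) κ = diagramDelta D (κ ∘ f) := by
  simp only [diagramDelta, Finset.prod_image (injOn_sym2Map hf), Finset.prod_apply, chordDelta,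
    Sym2.map_map]

namespace Sl2Trace

variable {A : Type*} [Ring A] [Algebra ℂ A] (R : Sl2Trace A)

theorem val_isRotated {L L' : List ℕ} (h : L ~r L') (D : Finset (Sym2 ℕ)) :
    R.val L D = R.val L' D := by
  obtain ⟨n, hn, rfl⟩ := List.isRotated_iff_mod.1 h
  rw [List.rotate_eq_drop_append_take hn, R.val_append_comm, List.take_append_drop]

theorem val_image {f : ℕ → ℕ} {L : List ℕ} {D : Finset (Sym2 ℕ)} (hf : Set.InjOn f (points D))
    (hL : L.toFinset = points D) :
    R.val (L.map f) (D.image (Sym2.map f)) = R.val L D := by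
  have himage : (L.map f).toFinset = L.toFinset.image f := by ext; simp
  have hdep : DependsOn (diagramDelta D * fun κ => R.tr (R.word L κ)) (L.toFinset : Set ℕ) := by
    have hword : DependsOn (fun κ => R.tr (R.word L κ)) (L.toFinset : Set ℕ) := fun κ κ' h =>
      congrArg R.tr (R.dependsOn_word L fun p hp => h p (by simpa using hp))
    have hdelta := dependsOn_diagramDelta D
    rw [← hL] at hdelta
    exact Set.union_self (L.toFinset : Set ℕ) ▸ dependsOn_mul hdelta hword
  rw [val, himage, val, ← colorSum_image (by rwa [hL]) hdep 0 0]
  simp only [Pi.mul_apply, word_map, ← diagramDelta_image hf]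
  rfl

theorem diagramVal_eq_of_sameDiagram {D D' : Finset (Sym2 ℕ)} (h : SameDiagram D D') :
    R.diagramVal D = R.diagramVal D' := by
  obtain ⟨f, hf, rfl, hcyc⟩ := h
  have hrot : ((points D).sort (· ≤ ·)).map f ~r
      (points (D.image (Sym2.map f))).sort (· ≤ ·) := by
    refine map_isRotated_of_cyclicallyOrdered (Finset.sortedLT_sort _) (Finset.sortedLT_sort _)
      (by simpa using hf) (fun r => ?_) (by simpa using hcyc)
    simp [points_image]
  rw [diagramVal, diagramVal, ← R.val_isRotated hrot, R.val_image hf (by simp)]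

end Sl2Trace

/-! ### The irreducible representations of `sl₂` -/

section Sl2Triple

variable {L : Type*} [LieRing L] [LieAlgebra ℂ L] {h e f : L}

/-- The orthonormal basis of the span of an `sl₂`-triple (the spin matrices, when the triple is
that of the defining representation). -/
noncomputable def spinBasis (h e f : L) : Fin 3 → L :=
  ![(1 / 2 : ℂ) • (e + f), (-Complex.I / 2) • (e - f), (1 / 2 : ℂ) • h]

theorem leviCivita_eq (a b c : Fin 3) : leviCivita a b c =
    (![![![0, 0, 0], ![0, 0, 1], ![0, -1, 0]], ![![0, 0, -1], ![0, 0, 0], ![1, 0, 0]],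
      ![![0, 1, 0], ![-1, 0, 0], ![0, 0, 0]]] : Fin 3 → Fin 3 → Fin 3 → ℤ) a b c := by
  revert a b c; decide

theorem lie_spinBasis (t : IsSl2Triple h e f) (a b : Fin 3) :
    ⁅spinBasis h e f a, spinBasis h e f b⁆ = ∑ c, structureConst a b c • spinBasis h e f c := by
  have hI : Complex.I * (-Complex.I / 2) = 1 / 2 := by
    linear_combination (-1 / 2 : ℂ) * Complex.I_mul_I
  have hfe : ⁅f, e⁆ = -h := by rw [← lie_skew, t.lie_e_f]
  have heh : ⁅e, h⁆ = -((2 : ℂ) • e) := by rw [← lie_skew, t.lie_h_e_smul ℂ]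
  have hfh : ⁅f, h⁆ = (2 : ℂ) • f := by rw [← lie_skew, t.lie_lie_smul_f ℂ, neg_neg]
  fin_cases a <;> fin_cases b <;>
    simp [Fin.sum_univ_three, structureConst, leviCivita_eq, spinBasis, t.lie_e_f,
      t.lie_h_e_smul ℂ, t.lie_lie_smul_f ℂ, hfe, heh, hfh, smul_smul, hI] <;> module

end Sl2Triple

section Associative

attribute [local instance] LieRing.ofAssociativeRing

theorem sum_spinBasis_mul_spinBasis {A : Type*} [Ring A] [Algebra ℂ A] (h e f : A) :
    ∑ a, spinBasis h e f a * spinBasis h e f a =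
      (1 / 2 : ℂ) • (e * f + f * e) + (1 / 4 : ℂ) • (h * h) := by
  have hI : -Complex.I / 2 * (-Complex.I / 2) = -(1 / 4) := by
    linear_combination (1 / 4 : ℂ) * Complex.I_mul_I
  simp only [Fin.sum_univ_three, spinBasis, Matrix.cons_val, smul_mul_smul_comm, mul_add, add_mul,
    mul_sub, sub_mul, hI]
  module

end Associative

/-- The raising operator of the representation of dimension `N`, realized on the functions on
`Fin N`. -/
def raising (N : ℕ) : Module.End ℂ (Fin N → ℂ) where
  toFun g n := if h : n.1 + 1 < N then g ⟨n.1 + 1, h⟩ else 0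
  map_add' g g' := by funext n; by_cases h : n.1 + 1 < N <;> simp [h]
  map_smul' r g := by funext n; by_cases h : n.1 + 1 < N <;> simp [h]

/-- The lowering operator of the representation of dimension `N`; the truncated index is
harmless because its coefficient vanishes at `0`. -/
def lowering (N : ℕ) : Module.End ℂ (Fin N → ℂ) where
  toFun g n := n.1 * (N - n.1) * g ⟨n.1 - 1, by omega⟩
  map_add' g g' := by funext n; simp [mul_add]
  map_smul' r g := by funext n; simp only [Pi.smul_apply, smul_eq_mul, RingHom.id_apply]; ring

/-- The weight operator of the representation of dimension `N`. -/
def weightOperator (N : ℕ) : Module.End ℂ (Fin N → ℂ) where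
  toFun g n := (N - 1 - 2 * n.1) * g n
  map_add' g g' := by funext n; simp [mul_add]
  map_smul' r g := by funext n; simp only [Pi.smul_apply, smul_eq_mul, RingHom.id_apply]; ring

section Apply

variable {N : ℕ} (g : Fin N → ℂ) (n : Fin N)

theorem raising_apply :
    raising N g n = if h : n.1 + 1 < N then g ⟨n.1 + 1, h⟩ else 0 := rfl

theorem lowering_apply : lowering N g n = n.1 * (N - n.1) * g ⟨n.1 - 1, by omega⟩ := rfl

theorem weightOperator_apply : weightOperator N g n = (N - 1 - 2 * n.1) * g n := rfl

theorem raising_lowering_apply :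
    raising N (lowering N g) n = (n.1 + 1) * (N - n.1 - 1) * g n := by
  rw [raising_apply]
  split_ifs with h
  · simp only [lowering_apply, Nat.add_sub_cancel]
    push_cast
    ring
  · have hN : (N : ℂ) = n.1 + 1 := by
      exact_mod_cast (show N = n.1 + 1 by omega)
    rw [hN]
    ring

theorem lowering_raising_apply : lowering N (raising N g) n = n.1 * (N - n.1) * g n := by
  rw [lowering_apply, raising_apply]
  rcases Nat.eq_zero_or_pos n.1 with h | h
  · simp [h]
  · simp only [Nat.sub_add_cancel h, n.2, dif_pos]

end Apply

theorem lie_raising_lowering (N : ℕ) : ⁅raising N, lowering N⁆ = weightOperator N := by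
  refine LinearMap.ext fun g => funext fun n => ?_
  simp only [Ring.lie_def, LinearMap.sub_apply, Module.End.mul_apply, Pi.sub_apply,
    raising_lowering_apply, lowering_raising_apply, weightOperator_apply]
  ring

theorem lie_weightOperator_raising (N : ℕ) : ⁅weightOperator N, raising N⁆ = 2 • raising N := by
  refine LinearMap.ext fun g => funext fun n => ?_
  simp only [Ring.lie_def, LinearMap.sub_apply, Module.End.mul_apply, Pi.sub_apply,
    weightOperator_apply, raising_apply, two_smul, LinearMap.add_apply, Pi.add_apply]
  split_ifs
  · push_cast
    ring
  · ring

theorem lie_weightOperator_lowering (N : ℕ) :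
    ⁅weightOperator N, lowering N⁆ = -(2 • lowering N) := by
  refine LinearMap.ext fun g => funext fun n => ?_
  simp only [Ring.lie_def, LinearMap.sub_apply, Module.End.mul_apply, Pi.sub_apply,
    weightOperator_apply, lowering_apply, LinearMap.neg_apply, Pi.neg_apply, two_smul,
    LinearMap.add_apply, Pi.add_apply]
  rcases Nat.eq_zero_or_pos n.1 with h | h
  · simp [h]
  · push_cast [Nat.cast_sub h]
    ring

theorem casimir_apply (N : ℕ) :
    (1 / 2 : ℂ) • (raising N * lowering N + lowering N * raising N) +
      (1 / 4 : ℂ) • (weightOperator N * weightOperator N) =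
        (((N : ℂ) ^ 2 - 1) / 4) • (1 : Module.End ℂ (Fin N → ℂ)) := by
  refine LinearMap.ext fun g => funext fun n => ?_
  simp only [LinearMap.add_apply, Module.End.mul_apply, Pi.add_apply, raising_lowering_apply,
    lowering_raising_apply, weightOperator_apply, LinearMap.smul_apply, Pi.smul_apply, smul_eq_mul,
    Module.End.one_apply]
  ring

section Irreducible

attribute [local instance] LieRing.ofAssociativeRing

theorem isSl2Triple_weightOperator (n : ℕ) :
    IsSl2Triple (weightOperator (n + 2)) (raising (n + 2)) (lowering (n + 2)) where
  h_ne_zero h := by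
    have h0 := congrFun (LinearMap.congr_fun h 1) 0
    rw [weightOperator_apply] at h0
    have hn : (n : ℂ) + 1 = 0 := by
      simp only [Fin.val_zero, Pi.one_apply, LinearMap.zero_apply, Pi.zero_apply] at h0
      push_cast at h0
      linear_combination h0
    exact Nat.cast_add_one_ne_zero n hn
  lie_e_f := lie_raising_lowering _
  lie_h_e_nsmul := lie_weightOperator_raising _
  lie_h_f_nsmul := lie_weightOperator_lowering _

/-- The irreducible representation of dimension `n + 2`, with its normalized trace. The trivial
representation is left out because `IsSl2Triple` asks for a nonzero weight operator. -/
noncomputable def irreducible (n : ℕ) : Sl2Trace (Module.End ℂ (Fin (n + 2) → ℂ)) where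
  J := spinBasis (weightOperator _) (raising _) (lowering _)
  x := (((n + 2 : ℕ) : ℂ) ^ 2 - 1) / 4
  tr := (1 / ((n + 2 : ℕ) : ℂ)) • LinearMap.trace ℂ _
  lie := lie_spinBasis (isSl2Triple_weightOperator n)
  casimir := (sum_spinBasis_mul_spinBasis _ _ _).trans (casimir_apply _)
  tr_mul_comm a b := by rw [LinearMap.smul_apply, LinearMap.smul_apply, LinearMap.trace_mul_comm]
  tr_one := by
    have hn : ((n + 2 : ℕ) : ℂ) ≠ 0 := Nat.cast_ne_zero.2 (by omega)
    simp only [LinearMap.smul_apply, LinearMap.trace_one, Module.finrank_fin_fun, smul_eq_mul]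
    exact one_div_mul_cancel hn

end Irreducible

theorem injective_irreducible_x : Function.Injective fun n => (irreducible n).x := by
  intro m n h
  have h' : ((m + 2 : ℕ) : ℂ) ^ 2 = ((n + 2 : ℕ) : ℂ) ^ 2 := by
    simp only [irreducible] at h
    linear_combination 4 * h
  have := Nat.pow_left_injective two_ne_zero (by exact_mod_cast h')
  omega

theorem eq_of_forall_aeval_irreducible {p q : ℤ[X]}
    (h : ∀ n, aeval (irreducible n).x p = aeval (irreducible n).x q) : p = q := by
  have hinj : Function.Injective (algebraMap ℤ ℂ) := (algebraMap ℤ ℂ).injective_int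
  refine map_injective _ hinj (eq_of_infinite_eval_eq _ _
    ((Set.infinite_range_of_injective injective_irreducible_x).mono ?_))
  rintro _ ⟨n, rfl⟩
  exact (eval_map_algebraMap p _).trans ((h n).trans (eval_map_algebraMap q _).symm)

theorem crossing_singleton (a : Sym2 ℕ) : crossing {a} a = ∅ := by
  refine Finset.eq_empty_of_forall_notMem fun c hc => ?_
  simp only [crossing, Finset.mem_filter, Finset.mem_singleton] at hc
  obtain ⟨-, rfl, hc, -⟩ := hc
  simp only [Sym2.inf_mk, Sym2.sup_mk] at hc
  grind

theorem isUniversalSl2Weight_weight : IsUniversalSl2Weight weight where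
  one_chord D hD hcard := by
    obtain ⟨a, rfl⟩ := Finset.card_eq_one.1 hcard
    refine eq_of_forall_aeval_irreducible fun n => ?_
    rw [Sl2Trace.aeval_weight _ hD,
      Sl2Trace.diagramVal_recursion _ hD (Finset.mem_singleton_self a), crossing_singleton,
      Finset.erase_singleton, Sl2Trace.diagramVal_empty]
    simp
  recursion D hD _ a ha := eq_of_forall_aeval_irreducible fun n => by
    rw [Sl2Trace.aeval_weight _ hD,
      Sl2Trace.aeval_recursionRHS _ hD ha fun E hE _ => Sl2Trace.aeval_weight _ hE]
  invariant D D' hD hD' h := eq_of_forall_aeval_irreducible fun n => by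
    rw [Sl2Trace.aeval_weight _ hD, Sl2Trace.aeval_weight _ hD',
      Sl2Trace.diagramVal_eq_of_sameDiagram _ h]

/-! ### The split Casimir element -/

theorem sum_structureConst_swap_mul (s c u d : Fin 3) :
    ∑ t, structureConst s t c * structureConst t u d =
      (if s = u then 1 else 0) * (if c = d then 1 else 0) -
        (if s = d then 1 else 0) * (if c = u then 1 else 0) := by
  simp only [structureConst_swap_left s, neg_mul, Finset.sum_neg_distrib, sum_structureConst_mul,
    neg_sub]

theorem sum_structureConst_smul_smul {M : Type*} [AddCommGroup M] [Module ℂ M] (s : Fin 3)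
    (G : Fin 3 → Fin 3 → Fin 3 → M) :
    ∑ t, ∑ c, structureConst s t c • ∑ u, ∑ d, structureConst t u d • G c u d =
      ∑ c, (G c s c - G c c s) := by
  have hcoeff (t : Fin 3) : ∑ c, structureConst s t c • ∑ u, ∑ d, structureConst t u d • G c u d =
      ∑ p : Fin 3 × Fin 3 × Fin 3,
        (structureConst s t p.1 * structureConst t p.2.1 p.2.2) • G p.1 p.2.1 p.2.2 := by
    simp only [Fintype.sum_prod_type, Finset.smul_sum, smul_smul]
  simp only [hcoeff]
  rw [Finset.sum_comm]
  simp only [← Finset.sum_smul, sum_structureConst_swap_mul, Fintype.sum_prod_type, sub_smul,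
    Finset.sum_sub_distrib]
  simp only [mul_smul, ite_smul, one_smul, zero_smul, Finset.sum_ite_irrel, Finset.sum_const_zero,
    Finset.sum_ite_eq, Finset.mem_univ, if_true]

namespace Sl2Trace

open scoped TensorProduct

variable {A : Type*} [Ring A] [Algebra ℂ A] (R : Sl2Trace A)

/-- The action of the basis of `sl₂` on the first factor of `A ⊗ A`. -/
def left (s : Fin 3) : A ⊗[ℂ] A := R.J s ⊗ₜ 1

/-- The action of the basis of `sl₂` on the second factor of `A ⊗ A`. -/
def right (s : Fin 3) : A ⊗[ℂ] A := 1 ⊗ₜ R.J s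

/-- The split Casimir element `Ω` of `A ⊗ A`. -/
def omega : A ⊗[ℂ] A := ∑ s, R.left s * R.right s

/-- The linear form `P ⊗ Q ↦ tr (P Q)` on `A ⊗ A`. -/
def trMul : A ⊗[ℂ] A →ₗ[ℂ] ℂ := R.tr ∘ₗ LinearMap.mul' ℂ A

@[simp] theorem trMul_tmul (P Q : A) : R.trMul (P ⊗ₜ Q) = R.tr (P * Q) := by simp [trMul]

theorem commute_left_right (s t : Fin 3) : Commute (R.left s) (R.right t) := by
  simp [Commute, SemiconjBy, left, right]

theorem left_lie_left (s t : Fin 3) :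
    ⁅R.left s, R.left t⁆ = ∑ c, structureConst s t c • R.left c := by
  have h := congr_arg (· ⊗ₜ[ℂ] (1 : A)) (R.lie s t)
  simpa [left, Ring.lie_def, TensorProduct.sub_tmul, TensorProduct.sum_tmul,
    TensorProduct.smul_tmul'] using h

theorem right_lie_right (s t : Fin 3) :
    ⁅R.right s, R.right t⁆ = ∑ c, structureConst s t c • R.right c := by
  have h := congr_arg ((1 : A) ⊗ₜ[ℂ] ·) (R.lie s t)
  simpa [right, Ring.lie_def, TensorProduct.tmul_sub, TensorProduct.tmul_sum] using h

theorem sum_left_mul_left : ∑ s, R.left s * R.left s = R.x • 1 := by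
  simpa [left, TensorProduct.sum_tmul, TensorProduct.smul_tmul',
    Algebra.TensorProduct.one_def] using congr_arg (· ⊗ₜ[ℂ] (1 : A)) R.casimir

theorem sum_right_mul_right : ∑ s, R.right s * R.right s = R.x • 1 := by
  simpa [right, TensorProduct.tmul_sum, Algebra.TensorProduct.one_def] using
    congr_arg ((1 : A) ⊗ₜ[ℂ] ·) R.casimir

theorem sum_left_mul_left_mul_left (c : Fin 3) :
    ∑ s, R.left s * R.left c * R.left s = (R.x - 1) • R.left c := by
  simpa [left, TensorProduct.sum_tmul, TensorProduct.smul_tmul'] using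
    congr_arg (· ⊗ₜ[ℂ] (1 : A)) (R.sum_J_mul_J_mul_J c)

theorem left_lie_omega (s : Fin 3) :
    ⁅R.left s, R.omega⁆ = ∑ t, ∑ c, structureConst s t c • (R.left c * R.right t) := by
  rw [Ring.lie_def, omega, Finset.mul_sum, Finset.sum_mul, ← Finset.sum_sub_distrib]
  refine Finset.sum_congr rfl fun t _ => ?_
  simp only [← smul_mul_assoc]
  rw [← Finset.sum_mul, ← left_lie_left, Ring.lie_def, sub_mul, mul_assoc _ (R.right t),
    ← (R.commute_left_right s t).eq, mul_assoc, mul_assoc]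

theorem right_lie_omega (s : Fin 3) :
    ⁅R.right s, R.omega⁆ = ∑ t, ∑ c, structureConst s t c • (R.left t * R.right c) := by
  rw [Ring.lie_def, omega, Finset.mul_sum, Finset.sum_mul, ← Finset.sum_sub_distrib]
  refine Finset.sum_congr rfl fun t _ => ?_
  simp only [← mul_smul_comm]
  rw [← Finset.mul_sum, ← right_lie_right, Ring.lie_def, mul_sub, ← mul_assoc,
    ← (R.commute_left_right t s).eq, mul_assoc, mul_assoc]

theorem right_lie_omega_eq_neg (s : Fin 3) : ⁅R.right s, R.omega⁆ = -⁅R.left s, R.omega⁆ := by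
  rw [right_lie_omega, left_lie_omega, Finset.sum_comm, ← Finset.sum_neg_distrib]
  refine Finset.sum_congr rfl fun t _ => ?_
  rw [← Finset.sum_neg_distrib]
  exact Finset.sum_congr rfl fun c _ => by rw [structureConst_swap_right, neg_smul]

theorem commute_left_add_right_omega (s : Fin 3) : Commute (R.left s + R.right s) R.omega := by
  have h := R.right_lie_omega_eq_neg s
  rw [Ring.lie_def, Ring.lie_def, ← add_eq_zero_iff_eq_neg] at h
  rw [commute_iff_eq, ← sub_eq_zero, ← h]
  noncomm_ring

theorem left_mul_right_lie_omega (c t : Fin 3) :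
    ⁅R.left c * R.right t, R.omega⁆ =
      ∑ u, ∑ d, structureConst t u d • (R.left c * R.left u * R.right d) +
        ∑ u, ∑ d, structureConst c u d • (R.left d * R.right u * R.right t) := by
  have h : ⁅R.left c * R.right t, R.omega⁆ =
      R.left c * ⁅R.right t, R.omega⁆ + ⁅R.left c, R.omega⁆ * R.right t := by
    simp only [Ring.lie_def]
    noncomm_ring
  simp only [h, left_lie_omega, right_lie_omega, Finset.mul_sum, Finset.sum_mul, mul_smul_comm,
    smul_mul_assoc, mul_assoc]

theorem left_lie_omega_lie_omega (s : Fin 3) :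
    ⁅⁅R.left s, R.omega⁆, R.omega⁆ =
      R.omega * R.left s - R.right s * R.omega + R.x • (R.left s - R.right s) := by
  have hexpand : ⁅⁅R.left s, R.omega⁆, R.omega⁆ =
      ∑ t, ∑ c, structureConst s t c • ⁅R.left c * R.right t, R.omega⁆ := by
    rw [left_lie_omega, Ring.lie_def]
    simp only [Ring.lie_def, Finset.sum_mul, Finset.mul_sum, smul_mul_assoc, mul_smul_comm,
      smul_sub, Finset.sum_sub_distrib]
  have hright : ∑ t, ∑ c, structureConst s t c •
      ∑ u, ∑ d, structureConst t u d • (R.left c * R.left u * R.right d) =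
        R.omega * R.left s - R.x • R.right s := by
    rw [sum_structureConst_smul_smul s fun c u d => R.left c * R.left u * R.right d]
    simp only [Finset.sum_sub_distrib, mul_assoc _ (R.left s), (R.commute_left_right s _).eq]
    simp only [← mul_assoc, ← Finset.sum_mul, sum_left_mul_left, smul_mul_assoc, one_mul, omega]
  have hleft : ∑ t, ∑ c, structureConst s t c •
      ∑ u, ∑ d, structureConst c u d • (R.left d * R.right u * R.right t) =
        R.x • R.left s - R.right s * R.omega := by
    have h := sum_structureConst_smul_smul s fun c u d => R.left d * R.right u * R.right c
    rw [Finset.sum_comm]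
    conv_lhs => enter [2, c, 2, t]; rw [structureConst_swap_right, neg_smul]
    simp only [Finset.sum_neg_distrib, h]
    simp only [Finset.sum_sub_distrib, (R.commute_left_right _ s).eq]
    simp only [mul_assoc, ← Finset.mul_sum, sum_right_mul_right, mul_smul_comm, mul_one, omega,
      neg_sub]
  simp only [hexpand, left_mul_right_lie_omega, smul_add, Finset.sum_add_distrib]
  rw [hright, hleft]
  module

/-- The cubic relation that is behind the recurrence of the Kreweras triangle. -/
theorem left_mul_omega_cubic (s : Fin 3) :
    R.left s * R.omega ^ 3 - (3 : ℂ) • (R.omega * R.left s * R.omega ^ 2) +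
        (3 : ℂ) • (R.omega ^ 2 * R.left s * R.omega) - R.omega ^ 3 * R.left s =
      R.left s * R.omega ^ 2 - R.omega ^ 2 * R.left s +
        (2 * R.x) • (R.left s * R.omega - R.omega * R.left s) := by
  have hright := R.right_lie_omega_eq_neg s
  have hcubic : ⁅⁅⁅R.left s, R.omega⁆, R.omega⁆, R.omega⁆ =
      R.omega * ⁅R.left s, R.omega⁆ - ⁅R.right s, R.omega⁆ * R.omega +
        R.x • (⁅R.left s, R.omega⁆ - ⁅R.right s, R.omega⁆) := by
    rw [left_lie_omega_lie_omega]
    simp only [Ring.lie_def, add_mul, mul_add, sub_mul, mul_sub, smul_mul_assoc, mul_smul_comm,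
      mul_assoc]
    module
  rw [hright] at hcubic
  simp only [Ring.lie_def] at hcubic
  calc _ = ((R.left s * R.omega - R.omega * R.left s) * R.omega -
        R.omega * (R.left s * R.omega - R.omega * R.left s)) * R.omega -
      R.omega * ((R.left s * R.omega - R.omega * R.left s) * R.omega -
        R.omega * (R.left s * R.omega - R.omega * R.left s)) := by
        simp only [ofNat_smul_eq_nsmul]
        noncomm_ring
    _ = _ := by
        rw [hcubic]
        simp only [pow_two, mul_sub, sub_mul, mul_assoc, neg_mul]
        module

theorem trMul_left_mul (s : Fin 3) (Z : A ⊗[ℂ] A) :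
    R.trMul (R.left s * Z) = R.trMul (Z * R.right s) := by
  induction Z with
  | zero => simp
  | tmul P Q => simp [left, right, R.tr_mul_comm (R.J s), mul_assoc]
  | add Z Z' hZ hZ' => rw [mul_add, add_mul, map_add, map_add, hZ, hZ']

theorem trMul_right_mul (s : Fin 3) (Z : A ⊗[ℂ] A) :
    R.trMul (R.right s * Z) = R.trMul (Z * R.left s) := by
  induction Z with
  | zero => simp
  | tmul P Q => simp [left, right, mul_assoc]
  | add Z Z' hZ hZ' => rw [mul_add, add_mul, map_add, map_add, hZ, hZ']

theorem trMul_left_mul_right_mul (s t : Fin 3) (Z : A ⊗[ℂ] A) :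
    R.trMul (R.left s * R.right t * Z) = R.trMul (Z * (R.left t * R.right s)) := by
  rw [mul_assoc, trMul_left_mul, mul_assoc, trMul_right_mul, mul_assoc,
    (R.commute_left_right t s).eq]

theorem trMul_omega_mul (Z : A ⊗[ℂ] A) : R.trMul (R.omega * Z) = R.trMul (Z * R.omega) := by
  simp only [omega, Finset.sum_mul, Finset.mul_sum, map_sum, trMul_left_mul_right_mul]

theorem trMul_omega_pow_mul (n : ℕ) (Z : A ⊗[ℂ] A) :
    R.trMul (R.omega ^ n * Z) = R.trMul (Z * R.omega ^ n) := by
  induction n generalizing Z with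
  | zero => simp
  | succ n ih => rw [pow_succ, mul_assoc, ih, mul_assoc, trMul_omega_mul, mul_assoc]

/-- The value of `𝒟_n`. -/
noncomputable def valD (n : ℕ) : ℂ := R.trMul (R.omega ^ n)

/-- The value of `𝒜_{q+m+1,q}`. -/
noncomputable def valA (q m : ℕ) : ℂ :=
  ∑ s, R.trMul (R.left s * R.omega ^ q * R.left s * R.omega ^ m)

/-- The value of `ℬ_{q+m+2,q}`. -/
noncomputable def valB (q m : ℕ) : ℂ :=
  ∑ s, ∑ t, R.trMul (R.left s * R.right t * R.omega ^ q * (R.left s * R.right t) * R.omega ^ m)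

theorem valA_third_difference (q m : ℕ) :
    R.valA q (m + 3) - 3 * R.valA (q + 1) (m + 2) + 3 * R.valA (q + 2) (m + 1) - R.valA (q + 3) m =
      R.valA q (m + 2) - R.valA (q + 2) m +
        2 * R.x * (R.valA q (m + 1) - R.valA (q + 1) m) := by
  have h := Finset.sum_congr (rfl : Finset.univ = Finset.univ) fun s _ => congr_arg
    (fun Z => R.trMul (R.left s * R.omega ^ q * Z * R.omega ^ m)) (R.left_mul_omega_cubic s)
  simp only [mul_add, mul_sub, add_mul, sub_mul, mul_smul_comm, smul_mul_assoc, map_add, map_sub,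
    map_smul, smul_eq_mul, Finset.sum_add_distrib, Finset.sum_sub_distrib, ← Finset.mul_sum] at h
  simp only [valA, add_comm m, pow_add, pow_one, mul_assoc] at h ⊢
  linear_combination h

theorem valA_zero_left (n : ℕ) : R.valA 0 n = R.x * R.valD n := by
  simp only [valA, valD, pow_zero, mul_one, ← map_sum, ← Finset.sum_mul, sum_left_mul_left,
    smul_mul_assoc, one_mul, map_smul, smul_eq_mul]

theorem valA_zero_right (n : ℕ) : R.valA n 0 = R.valD (n + 1) := by
  simp only [valA, valD, pow_zero, mul_one, mul_assoc, trMul_left_mul, pow_succ]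
  rw [omega, Finset.mul_sum, map_sum]

theorem sum_left_mul_omega_mul_left :
    ∑ s, R.left s * R.omega * R.left s = (R.x - 1) • R.omega := by
  have h (s t : Fin 3) : R.left s * (R.left t * R.right t) * R.left s =
      R.left s * R.left t * R.left s * R.right t := by
    rw [← mul_assoc, mul_assoc _ (R.right t), ← (R.commute_left_right s t).eq,
      mul_assoc _ _ (R.right t)]
  simp only [omega, Finset.mul_sum, Finset.sum_mul, h]
  rw [Finset.sum_comm]
  simp only [← Finset.sum_mul, sum_left_mul_left_mul_left, smul_mul_assoc, ← Finset.smul_sum]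

theorem sum_left_mul_omega_mul_right :
    ∑ s, R.left s * R.omega * R.right s = R.omega ^ 2 + R.omega := by
  have h (s : Fin 3) : R.left s * R.omega * R.right s =
      R.left s * R.left s * R.omega + R.left s * R.right s * R.omega -
        R.left s * R.omega * R.left s := by
    rw [← add_mul, ← mul_add, mul_assoc _ _ R.omega, (R.commute_left_add_right_omega s).eq]
    noncomm_ring
  simp only [h, Finset.sum_sub_distrib, Finset.sum_add_distrib, ← Finset.sum_mul, sum_left_mul_left,
    sum_left_mul_omega_mul_left]
  rw [← omega, ← pow_two, smul_mul_assoc, one_mul]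
  module

theorem valA_one_left (n : ℕ) : R.valA 1 n = (R.x - 1) * R.valD (n + 1) := by
  rw [valA, valD, pow_succ' R.omega n, ← map_sum, ← Finset.sum_mul]
  simp only [pow_one, sum_left_mul_omega_mul_left, smul_mul_assoc, map_smul, smul_eq_mul]

theorem valB_zero_left (n : ℕ) : R.valB 0 n = R.x ^ 2 * R.valD n := by
  have h (s t : Fin 3) : R.left s * R.right t * (R.left s * R.right t) =
      R.left s * R.left s * (R.right t * R.right t) := by
    rw [mul_assoc, ← mul_assoc (R.right t), ← (R.commute_left_right s t).eq]
    simp only [mul_assoc]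
  simp only [valB, valD, pow_zero, mul_one, h, ← map_sum, ← Finset.sum_mul, ← Finset.mul_sum,
    sum_left_mul_left, sum_right_mul_right, smul_mul_assoc, mul_smul_comm, one_mul, map_smul,
    smul_eq_mul]
  ring

theorem valB_zero_right (n : ℕ) : R.valB n 0 = R.valD (n + 2) + R.valD (n + 1) := by
  have h (s t : Fin 3) : R.trMul (R.left s * R.right t * R.omega ^ n * (R.left s * R.right t)) =
      R.trMul (R.omega ^ n * (R.left s * (R.left t * R.right t) * R.right s)) := by
    rw [mul_assoc (R.left s * R.right t), trMul_left_mul_right_mul, (R.commute_left_right t t).eq]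
    simp only [mul_assoc]
  have homega : ∑ s, R.left s * (∑ t, R.left t * R.right t) * R.right s = R.omega ^ 2 + R.omega :=
    R.sum_left_mul_omega_mul_right
  simp only [valB, pow_zero, mul_one, h, ← map_sum, ← Finset.mul_sum, ← Finset.sum_mul, homega]
  rw [mul_add, map_add, ← pow_add, ← pow_succ, valD, valD]

theorem sum_omega_lie_left_mul_left_lie_omega (Z : A ⊗[ℂ] A) :
    ∑ s, ⁅R.omega, R.left s⁆ * Z * ⁅R.left s, R.omega⁆ =
      ∑ s, ∑ t, (R.left s * R.right t * Z * (R.left s * R.right t) -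
        R.left s * R.right t * Z * (R.left t * R.right s)) := by
  have hterm (s : Fin 3) : ⁅R.omega, R.left s⁆ * Z * ⁅R.left s, R.omega⁆ =
      ∑ p : (Fin 3 × Fin 3) × Fin 3 × Fin 3,
        (structureConst s p.1.1 p.1.2 * structureConst s p.2.1 p.2.2) •
          (R.left p.1.1 * R.right p.1.2 * Z * (R.left p.2.2 * R.right p.2.1)) := by
    have hlie : ⁅R.omega, R.left s⁆ =
        ∑ c, ∑ t, structureConst s c t • (R.left c * R.right t) := by
      rw [← right_lie_omega, right_lie_omega_eq_neg, Ring.lie_def, Ring.lie_def, neg_sub]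
    rw [hlie, left_lie_omega]
    simp only [Finset.sum_mul, smul_mul_assoc]
    simp only [Finset.mul_sum, mul_smul_comm, Finset.smul_sum, smul_smul, Fintype.sum_prod_type]
  simp only [hterm]
  rw [Finset.sum_comm]
  simp only [← Finset.sum_smul, sum_structureConst_mul, Fintype.sum_prod_type, sub_smul,
    Finset.sum_sub_distrib]
  simp only [mul_smul, ite_smul, one_smul, zero_smul, Finset.sum_ite_irrel, Finset.sum_const_zero,
    Finset.sum_ite_eq, Finset.mem_univ, if_true]

theorem valA_second_difference (q m : ℕ) :
    R.valA q (m + 2) - 2 * R.valA (q + 1) (m + 1) + R.valA (q + 2) m =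
      R.valB q m - R.valB m q := by
  have hcross : ∑ s, ∑ t, R.trMul (R.left s * R.right t * R.omega ^ q *
      (R.left t * R.right s) * R.omega ^ m) = R.valB m q := by
    rw [Finset.sum_comm, valB]
    refine Finset.sum_congr rfl fun t _ => Finset.sum_congr rfl fun s _ => ?_
    simp only [mul_assoc (R.left s * R.right t)]
    rw [trMul_left_mul_right_mul, mul_assoc (R.omega ^ q), mul_assoc (R.omega ^ q),
      trMul_omega_pow_mul]
  have h := congr_arg (fun Z => R.trMul (Z * R.omega ^ m))
    (R.sum_omega_lie_left_mul_left_lie_omega (R.omega ^ q))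
  simp only [Ring.lie_def, mul_sub, sub_mul, Finset.sum_sub_distrib, Finset.sum_mul, map_sub,
    map_sum, hcross] at h
  simp only [mul_assoc, trMul_omega_mul] at h
  simp only [valA, valB, pow_add, mul_assoc, pow_one, pow_two,
    (Commute.self_pow R.omega _).eq, (Commute.self_pow R.omega _).left_comm] at h ⊢
  linear_combination h

end Sl2Trace

/-! ### Diagrams built from parallel chords -/

theorem points_union (D D' : Finset (Sym2 ℕ)) : points (D ∪ D') = points D ∪ points D' :=
  Finset.union_biUnion

theorem points_singleton (p q : ℕ) : points {s(p, q)} = {p, q} := by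
  ext r
  simp [mem_points]

theorem disjoint_of_disjoint_points {D D' : Finset (Sym2 ℕ)} (h : Disjoint (points D) (points D')) :
    Disjoint D D' := by
  rw [Finset.disjoint_left] at h ⊢
  intro c hc hc'
  induction c with
  | _ p q => exact h (mem_points.2 ⟨_, hc, Sym2.mem_mk_left p q⟩) (mem_points.2 ⟨_, hc', by simp⟩)

theorem isChordDiagram_union {D D' : Finset (Sym2 ℕ)} (hD : IsChordDiagram D)
    (hD' : IsChordDiagram D') (h : Disjoint (points D) (points D')) : IsChordDiagram (D ∪ D') := by
  have hne {c d : Sym2 ℕ} (hc : c ∈ D) (hd : d ∈ D') (p : ℕ) (hp : p ∈ c) : p ∉ d := fun hpd =>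
    Finset.disjoint_left.1 h (mem_points.2 ⟨c, hc, hp⟩) (mem_points.2 ⟨d, hd, hpd⟩)
  refine ⟨fun c hc => (Finset.mem_union.1 hc).elim (hD.1 c) (hD'.1 c), fun c hc d hd hcd p hp => ?_⟩
  rcases Finset.mem_union.1 hc with hc | hc <;> rcases Finset.mem_union.1 hd with hd | hd
  · exact hD.2 c hc d hd hcd p hp
  · exact hne hc hd p hp
  · exact fun hpd => hne hd hc p hpd hp
  · exact hD'.2 c hc d hd hcd p hp

/-- The chords that join the `n` consecutive points from `r` on, in order, to those from `r'` on. -/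
def parallel (r r' n : ℕ) : Finset (Sym2 ℕ) := (Finset.range n).image fun i => s(r + i, r' + i)

theorem parallel_succ (r r' n : ℕ) :
    parallel r r' (n + 1) = insert s(r, r') (parallel (r + 1) (r' + 1) n) := by
  ext c
  simp only [parallel, Finset.mem_insert, Finset.mem_image, Finset.mem_range,
    Nat.exists_lt_succ_left, add_zero, add_assoc, add_comm 1, eq_comm (b := c)]

theorem mem_points_parallel {r r' n p : ℕ} :
    p ∈ points (parallel r r' n) ↔ (r ≤ p ∧ p < r + n) ∨ (r' ≤ p ∧ p < r' + n) := by
  simp only [mem_points, parallel, Finset.exists_mem_image, Finset.mem_range, Sym2.mem_iff]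
  constructor
  · rintro ⟨i, hi, rfl | rfl⟩ <;> omega
  · rintro (h | h)
    · exact ⟨p - r, by omega, by omega⟩
    · exact ⟨p - r', by omega, by omega⟩

theorem isFresh_parallel {r r' n : ℕ} (h : r + n < r') :
    IsFresh (parallel (r + 1) (r' + 1) n) s(r, r') := by
  simp only [isFresh_mk, mem_points_parallel]
  omega

theorem isChordDiagram_parallel {r r' n : ℕ} (h : r + n ≤ r') :
    IsChordDiagram (parallel r r' n) := by
  induction n generalizing r r' with
  | zero => simp [parallel, IsChordDiagram]
  | succ n ih =>
    have hfresh : IsFresh (parallel (r + 1) (r' + 1) n) s(r, r') := isFresh_parallel h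
    rw [parallel_succ, isChordDiagram_insert hfresh.notMem]
    exact ⟨hfresh, ih (by omega)⟩

theorem disjoint_points_parallel {a a' k c c' b : ℕ} (hac : a + k ≤ c) (hca : c + b ≤ a')
    (hac' : a' + k ≤ c') :
    Disjoint (points (parallel a a' k)) (points (parallel c c' b)) := by
  simp only [Finset.disjoint_left, mem_points_parallel]
  omega

theorem isChordDiagram_parallel_union {a a' k c c' b : ℕ} (hac : a + k ≤ c) (hca : c + b ≤ a')
    (hac' : a' + k ≤ c') : IsChordDiagram (parallel a a' k ∪ parallel c c' b) :=
  isChordDiagram_union (isChordDiagram_parallel (by omega)) (isChordDiagram_parallel (by omega))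
    (disjoint_points_parallel hac hca hac')

theorem diagramD_eq_parallel (n : ℕ) : diagramD n = parallel 1 (n + 1) n := by
  ext c
  simp only [diagramD, parallel, Finset.mem_image, Finset.mem_Icc, Finset.mem_range]
  constructor
  · rintro ⟨i, hi, rfl⟩
    exact ⟨i - 1, by omega, by grind⟩
  · rintro ⟨i, hi, rfl⟩
    exact ⟨i + 1, by omega, by grind⟩

theorem diagramA_eq_insert (k b : ℕ) : diagramA (k + b + 1) k =
    insert s(1, k + 2) (parallel 2 (k + b + 3) k ∪ parallel (k + 3) (2 * k + b + 3) b) := by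
  ext c
  simp only [diagramA, parallel, Finset.mem_image, Finset.mem_Icc, Finset.mem_range,
    Finset.mem_insert, Finset.mem_union]
  constructor
  · rintro ⟨i, hi, rfl⟩
    split_ifs with h1 h2
    · exact .inl rfl
    · exact .inr (.inl ⟨i - 2, by omega, by grind⟩)
    · exact .inr (.inr ⟨i - (k + 2), by omega, by grind⟩)
  · rintro (rfl | ⟨i, hi, rfl⟩ | ⟨i, hi, rfl⟩)
    · exact ⟨1, by omega, rfl⟩
    · exact ⟨i + 2, by omega, by grind⟩
    · exact ⟨i + (k + 2), by omega, by grind⟩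

theorem diagramB_eq_insert (k b : ℕ) : diagramB (k + b + 2) k =
    insert s(1, k + 2) (insert s(k + b + 3, 2 * k + b + 4)
      (parallel 2 (k + b + 4) k ∪ parallel (k + 3) (2 * k + b + 5) b)) := by
  ext c
  simp only [diagramB, parallel, Finset.mem_image, Finset.mem_Icc, Finset.mem_range,
    Finset.mem_insert, Finset.mem_union]
  constructor
  · rintro ⟨i, hi, rfl⟩
    split_ifs with h1 h2 h3
    · exact .inl rfl
    · exact .inr (.inr (.inl ⟨i - 2, by omega, by grind⟩))
    · exact .inr (.inr (.inr ⟨i - (k + 2), by omega, by grind⟩))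
    · exact .inr (.inl (by grind))
  · rintro (rfl | rfl | ⟨i, hi, rfl⟩ | ⟨i, hi, rfl⟩)
    · exact ⟨1, by omega, rfl⟩
    · exact ⟨k + b + 2, by omega, by grind⟩
    · exact ⟨i + 2, by omega, by grind⟩
    · exact ⟨i + (k + 2), by omega, by grind⟩

theorem diagramB_pred_eq_diagramD {n : ℕ} (hn : 1 ≤ n) : diagramB n (n - 1) = diagramD n := by
  refine Finset.image_congr fun i hi => ?_
  rw [Finset.coe_Icc, Set.mem_Icc] at hi
  grind

/-! ### Contraction with the invariant tensor of a diagram -/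

theorem colorSum_comp_of_dependsOn {α ι M N : Type*} [DecidableEq α] [Fintype ι] [AddCommGroup M]
    [Module ℂ M] [AddCommGroup N] [Module ℂ N] {g : (α → ι) → M →ₗ[ℂ] N} {s : Set α}
    (hg : DependsOn g s) {S : Finset α} (hS : ∀ p ∈ S, p ∉ s) (G : (α → ι) → M) :
    colorSum S (fun κ => g κ (G κ)) = fun κ => g κ (colorSum S G κ) := by
  induction S using Finset.induction_on with
  | empty => simp
  | insert p S hp ih =>
    rw [Finset.forall_mem_insert] at hS
    rw [colorSum_insert_left hp, colorSum_insert_left hp, ih hS.2]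
    funext κ
    simp only [colorSumAt_apply, map_sum, update_eq_of_dependsOn hg hS.1]

section Contraction

variable {M N : Type*} [AddCommGroup M] [Module ℂ M] [AddCommGroup N] [Module ℂ N]

/-- Contraction of a function of a colouring, viewed as a tensor with coefficients in `M`, with the
invariant tensor of `D` at all points of `D`. -/
noncomputable def contraction (D : Finset (Sym2 ℕ)) (F : (ℕ → Fin 3) → M) : (ℕ → Fin 3) → M :=
  colorSum (points D) fun κ => diagramDelta D κ • F κ

theorem contraction_empty (F : (ℕ → Fin 3) → M) : contraction ∅ F = F := by
  simp [contraction, points, diagramDelta]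

theorem contraction_comp_of_dependsOn {D : Finset (Sym2 ℕ)} {g : (ℕ → Fin 3) → M →ₗ[ℂ] N}
    {s : Set ℕ} (hg : DependsOn g s) (hD : ∀ p ∈ points D, p ∉ s) (F : (ℕ → Fin 3) → M) :
    contraction D (fun κ => g κ (F κ)) = fun κ => g κ (contraction D F κ) := by
  simpa only [contraction, map_smul] using
    colorSum_comp_of_dependsOn hg hD fun κ => diagramDelta D κ • F κ

theorem contraction_union {D D' : Finset (Sym2 ℕ)} (h : Disjoint (points D) (points D'))
    (F : (ℕ → Fin 3) → M) : contraction (D ∪ D') F = contraction D (contraction D' F) := by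
  have hdep : DependsOn (fun κ => LinearMap.lsmul ℂ M (diagramDelta D κ)) (points D) :=
    fun κ κ' h => by simp only [dependsOn_diagramDelta D h]
  have hprod : diagramDelta (D ∪ D') = diagramDelta D * diagramDelta D' :=
    Finset.prod_union (disjoint_of_disjoint_points h)
  unfold contraction
  rw [points_union, colorSum_union h]
  congr 1
  simpa only [hprod, Pi.mul_apply, mul_smul, LinearMap.lsmul_apply] using
    colorSum_comp_of_dependsOn hdep
      (fun p hp hp' => Finset.disjoint_left.1 h hp' hp) fun κ => diagramDelta D' κ • F κ

theorem contraction_singleton {p q : ℕ} (hpq : p ≠ q) (F : (ℕ → Fin 3) → M) (κ : ℕ → Fin 3) :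
    contraction {s(p, q)} F κ = ∑ t, F (Function.update (Function.update κ p t) q t) := by
  rw [contraction, points_singleton, colorSum_insert_left (by simpa using hpq),
    ← insert_empty_eq, colorSum_insert_left (Finset.notMem_empty q)]
  simp [colorSumAt_apply, diagramDelta, chordDelta_mk, Function.update_of_ne hpq]

theorem contraction_insert {D : Finset (Sym2 ℕ)} {p q : ℕ} (hD : IsFresh D s(p, q))
    (F : (ℕ → Fin 3) → M) (κ : ℕ → Fin 3) :
    contraction (insert s(p, q) D) F κ =
      ∑ t, contraction D F (Function.update (Function.update κ p t) q t) := by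
  obtain ⟨hpq, hp, hq⟩ := isFresh_mk.1 hD
  have hdisj : Disjoint (points {s(p, q)}) (points D) := by
    simp [points_singleton, hp, hq]
  rw [Finset.insert_eq, contraction_union hdisj, contraction_singleton hpq]

end Contraction

namespace Sl2Trace

open scoped TensorProduct

variable {A : Type*} [Ring A] [Algebra ℂ A] (R : Sl2Trace A)

theorem diagramVal_eq_contraction {D : Finset (Sym2 ℕ)} {n : ℕ} (hD : points D = Finset.Icc 1 n) :
    R.diagramVal D = contraction D (fun κ => R.tr (R.word (List.range' 1 n) κ)) 0 := by
  have hsort : (points D).sort (· ≤ ·) = List.range' 1 n := by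
    have hIcc : Finset.Icc 1 n = (List.range' 1 n).toFinset := by
      ext p
      simp only [Finset.mem_Icc, List.mem_toFinset, List.mem_range'_1]
      omega
    rw [hD, hIcc]
    exact (List.toFinset_sort (· ≤ ·) List.nodup_range').2 List.pairwise_le_range'
  rw [diagramVal, val, Finset.sort_toFinset, hsort]
  rfl

/-- The words read along two blocks of `n` points, those from `r` on and those from `r'` on. -/
def wordPair (r r' n : ℕ) (κ : ℕ → Fin 3) : A ⊗[ℂ] A :=
  R.word (List.range' r n) κ ⊗ₜ R.word (List.range' r' n) κ

theorem dependsOn_wordPair (r r' n : ℕ) :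
    DependsOn (R.wordPair r r' n) (points (parallel r r' n)) := fun κ κ' h => by
  simp only [Finset.mem_coe, mem_points_parallel] at h
  have hr := R.dependsOn_word (List.range' r n) fun p hp => h p (.inl (by simpa using hp))
  have hr' := R.dependsOn_word (List.range' r' n) fun p hp => h p (.inr (by simpa using hp))
  rw [wordPair, hr, hr', wordPair]

theorem wordPair_succ (r r' n : ℕ) (κ : ℕ → Fin 3) :
    R.wordPair r r' (n + 1) κ =
      R.left (κ r) * R.right (κ r') * R.wordPair (r + 1) (r' + 1) n κ := by
  simp [wordPair, List.range'_succ, word_cons, left, right]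

theorem contraction_parallel {r r' n : ℕ} (h : r + n ≤ r') :
    contraction (parallel r r' n) (R.wordPair r r' n) = fun _ => R.omega ^ n := by
  induction n generalizing r r' with
  | zero =>
    simp [parallel, contraction_empty, wordPair, funext_iff, Algebra.TensorProduct.one_def]
  | succ n ih =>
    have hdep : DependsOn (fun κ : ℕ → Fin 3 =>
        LinearMap.mulLeft ℂ (R.left (κ r) * R.right (κ r'))) {p | p ∈ s(r, r')} :=
      fun κ κ' h => by simp only [h r (by simp), h r' (by simp)]
    have hfresh : IsFresh (parallel (r + 1) (r' + 1) n) s(r, r') := isFresh_parallel h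
    have hpeel := contraction_comp_of_dependsOn hdep (fun p hp hpr => hfresh.2 p hpr hp)
      (R.wordPair (r + 1) (r' + 1) n)
    simp only [LinearMap.mulLeft_apply, ih (by omega : r + 1 + n ≤ r' + 1)]
      at hpeel
    funext κ
    rw [parallel_succ, contraction_insert hfresh, funext (R.wordPair_succ r r' n)]
    simp only [hpeel, Function.update_self, Function.update_of_ne (by omega : r ≠ r'),
      ← Finset.sum_mul, pow_succ', omega]

theorem contraction_trMul_wordPair {r r' n : ℕ} (h : r + n ≤ r')
    {U V : (ℕ → Fin 3) → A ⊗[ℂ] A} {s : Set ℕ} (hU : DependsOn U s) (hV : DependsOn V s)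
    (hs : ∀ p ∈ points (parallel r r' n), p ∉ s) :
    contraction (parallel r r' n) (fun κ => R.trMul (U κ * R.wordPair r r' n κ * V κ)) =
      fun κ => R.trMul (U κ * R.omega ^ n * V κ) := by
  have hdep : DependsOn (fun κ => R.trMul ∘ₗ LinearMap.mulRight ℂ (V κ) ∘ₗ
      LinearMap.mulLeft ℂ (U κ)) s := fun κ κ' h => by simp only [hU h, hV h]
  simpa [R.contraction_parallel h] using
    contraction_comp_of_dependsOn hdep hs (R.wordPair r r' n)

theorem contraction_trMul_wordPair_wordPair {a a' k c c' b : ℕ} (hac : a + k ≤ c)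
    (hca : c + b ≤ a') (hac' : a' + k ≤ c') {U V : (ℕ → Fin 3) → A ⊗[ℂ] A} {s : Set ℕ}
    (hU : DependsOn U s) (hV : DependsOn V s)
    (hs : ∀ p ∈ points (parallel a a' k ∪ parallel c c' b), p ∉ s) :
    contraction (parallel a a' k ∪ parallel c c' b)
        (fun κ => R.trMul (U κ * R.wordPair a a' k κ * V κ * R.wordPair c c' b κ)) =
      fun κ => R.trMul (U κ * R.omega ^ k * V κ * R.omega ^ b) := by
  have hdisj := disjoint_points_parallel hac hca hac'
  simp only [points_union, Finset.mem_union, or_imp, forall_and] at hs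
  have hprefix : DependsOn (U * R.wordPair a a' k * V) (s ∪ points (parallel a a' k) ∪ s) :=
    dependsOn_mul (dependsOn_mul hU (R.dependsOn_wordPair a a' k)) hV
  have hs' : ∀ p ∈ points (parallel c c' b), p ∉ s ∪ points (parallel a a' k) ∪ s := by
    rintro p hp ((h | h) | h)
    · exact hs.2 p hp h
    · exact Finset.disjoint_left.1 hdisj h hp
    · exact hs.2 p hp h
  have hinner := R.contraction_trMul_wordPair (by omega : c + b ≤ c') hprefix
    (V := 1) (fun _ _ _ => rfl) hs'
  have houter := R.contraction_trMul_wordPair (by omega : a + k ≤ a') hU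
    (V := fun κ => V κ * R.omega ^ b) (fun κ κ' h => by simp only [hV h]) hs.1
  simp only [Pi.mul_apply, Pi.one_apply, mul_one, ← mul_assoc] at hinner houter
  rw [contraction_union hdisj, hinner, houter]

theorem aeval_weight_diagramD (n : ℕ) : aeval R.x (weight (diagramD n)) = R.valD n := by
  have hpoints : points (parallel 1 (n + 1) n) = Finset.Icc 1 (n + n) := by
    ext p
    rw [mem_points_parallel, Finset.mem_Icc]
    omega
  have hpar : 1 + n ≤ n + 1 := (add_comm 1 n).le
  have hword (κ : ℕ → Fin 3) :
      R.tr (R.word (List.range' 1 (n + n)) κ) = R.trMul (R.wordPair 1 (n + 1) n κ) := by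
    rw [wordPair, trMul_tmul, ← word_append, add_comm n 1, List.range'_append_1]
  have h := R.contraction_trMul_wordPair hpar (U := 1) (V := 1) (s := ∅) (fun _ _ _ => rfl)
    (fun _ _ _ => rfl) (fun _ _ => Set.notMem_empty _)
  simp only [Pi.one_apply, one_mul, mul_one] at h
  rw [diagramD_eq_parallel, R.aeval_weight (isChordDiagram_parallel hpar),
    R.diagramVal_eq_contraction hpoints]
  simp only [hword]
  rw [h, valD]

theorem tr_word_range'_of_two_blocks (k b : ℕ) (κ : ℕ → Fin 3) :
    R.tr (R.word (List.range' 1 (2 * (k + b + 1))) κ) =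
      R.trMul (R.left (κ 1) * R.wordPair 2 (k + b + 3) k κ * R.left (κ (k + 2)) *
        R.wordPair (k + 3) (2 * k + b + 3) b κ) := by
  have hlist : List.range' 1 (2 * (k + b + 1)) = 1 :: (List.range' 2 k ++ (k + 2) ::
      (List.range' (k + 3) b ++ (List.range' (k + b + 3) k ++ List.range' (2 * k + b + 3) b))) := by
    rw [show 2 * (k + b + 1) = (k + ((b + (k + b)) + 1)) + 1 by ring, List.range'_succ,
      ← List.range'_append_1, List.range'_succ, ← List.range'_append_1 (m := b),
      ← List.range'_append_1 (m := k)]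
    grind
  rw [hlist]
  simp only [word_cons, word_append, wordPair, left, Algebra.TensorProduct.tmul_mul_tmul,
    trMul_tmul, one_mul, mul_assoc]

theorem aeval_weight_diagramA {n k b : ℕ} (h : k + b + 1 = n) :
    aeval R.x (weight (diagramA n k)) = R.valA k b := by
  subst h
  set D := parallel 2 (k + b + 3) k ∪ parallel (k + 3) (2 * k + b + 3) b with hD
  have hmem (p : ℕ) : p ∈ points D ↔ p ∈ Finset.Icc 2 (2 * (k + b + 1)) ∧ p ≠ k + 2 := by
    rw [hD, points_union, Finset.mem_union, mem_points_parallel, mem_points_parallel,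
      Finset.mem_Icc]
    omega
  have hfresh : IsFresh D s(1, k + 2) := by simp [isFresh_mk, hmem]
  have hpoints : points (insert s(1, k + 2) D) = Finset.Icc 1 (2 * (k + b + 1)) := by
    ext p
    rw [mem_points_insert, hmem, Finset.mem_Icc, Finset.mem_Icc]
    omega
  have hchord : IsChordDiagram D :=
    isChordDiagram_parallel_union (by omega) (by omega) (by omega)
  have hcore := R.contraction_trMul_wordPair_wordPair (a := 2) (a' := k + b + 3) (k := k)
    (c := k + 3) (c' := 2 * k + b + 3) (b := b) (by omega) (by omega) (by omega)
    (U := fun κ => R.left (κ 1)) (V := fun κ => R.left (κ (k + 2)))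
    (s := {p | p ∈ s(1, k + 2)})
    (fun κ κ' h => by simp only [h 1 (by simp)]) (fun κ κ' h => by simp only [h (k + 2) (by simp)])
    (fun p hp hpc => hfresh.2 p hpc hp)
  rw [diagramA_eq_insert, R.aeval_weight ((isChordDiagram_insert hfresh.notMem).2 ⟨hfresh, hchord⟩),
    R.diagramVal_eq_contraction hpoints, contraction_insert hfresh,
    funext (R.tr_word_range'_of_two_blocks k b), hcore, valA]
  simp [Function.update_of_ne]

theorem tr_word_range'_of_four_blocks (k b : ℕ) (κ : ℕ → Fin 3) :
    R.tr (R.word (List.range' 1 (2 * (k + b + 2))) κ) =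
      R.trMul (R.left (κ 1) * R.right (κ (k + b + 3)) * R.wordPair 2 (k + b + 4) k κ *
        (R.left (κ (k + 2)) * R.right (κ (2 * k + b + 4))) *
          R.wordPair (k + 3) (2 * k + b + 5) b κ) := by
  have hlist : List.range' 1 (2 * (k + b + 2)) = 1 :: (List.range' 2 k ++ (k + 2) ::
      (List.range' (k + 3) b ++ (k + b + 3) :: (List.range' (k + b + 4) k ++
        (2 * k + b + 4) :: List.range' (2 * k + b + 5) b))) := by
    rw [show 2 * (k + b + 2) = (k + ((b + ((k + (b + 1)) + 1)) + 1)) + 1 by ring, List.range'_succ,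
      ← List.range'_append_1, List.range'_succ, ← List.range'_append_1 (m := b), List.range'_succ,
      ← List.range'_append_1 (m := k), List.range'_succ]
    grind
  rw [hlist]
  simp only [word_cons, word_append, wordPair, left, right, Algebra.TensorProduct.tmul_mul_tmul,
    trMul_tmul, one_mul, mul_one, mul_assoc]

theorem mem_points_parallel_union_of_four_blocks {k b p : ℕ} :
    p ∈ points (parallel 2 (k + b + 4) k ∪ parallel (k + 3) (2 * k + b + 5) b) ↔
      p ∈ Finset.Icc 2 (2 * (k + b + 2)) ∧ p ≠ k + 2 ∧ p ≠ k + b + 3 ∧ p ≠ 2 * k + b + 4 := by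
  rw [points_union, Finset.mem_union, mem_points_parallel, mem_points_parallel, Finset.mem_Icc]
  omega

theorem aeval_weight_diagramB {n k b : ℕ} (h : k + b + 2 = n) :
    aeval R.x (weight (diagramB n k)) = R.valB k b := by
  subst h
  set D := parallel 2 (k + b + 4) k ∪ parallel (k + 3) (2 * k + b + 5) b with hD
  have hmem (p : ℕ) := mem_points_parallel_union_of_four_blocks (k := k) (b := b) (p := p)
  rw [← hD] at hmem
  have hfresh : IsFresh D s(k + b + 3, 2 * k + b + 4) := by
    simp only [isFresh_mk, hmem, Finset.mem_Icc]
    omega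
  have hfresh' : IsFresh (insert s(k + b + 3, 2 * k + b + 4) D) s(1, k + 2) := by
    simp only [isFresh_mk, mem_points_insert, hmem, Finset.mem_Icc]
    omega
  have hpoints : points (insert s(1, k + 2) (insert s(k + b + 3, 2 * k + b + 4) D)) =
      Finset.Icc 1 (2 * (k + b + 2)) := by
    ext p
    rw [mem_points_insert, mem_points_insert, hmem, Finset.mem_Icc, Finset.mem_Icc]
    omega
  have hchord : IsChordDiagram (insert s(1, k + 2) (insert s(k + b + 3, 2 * k + b + 4) D)) := by
    rw [isChordDiagram_insert hfresh'.notMem, isChordDiagram_insert hfresh.notMem]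
    exact ⟨hfresh', hfresh, isChordDiagram_parallel_union (by omega) (by omega) (by omega)⟩
  have hcore := R.contraction_trMul_wordPair_wordPair (a := 2) (a' := k + b + 4) (k := k)
    (c := k + 3) (c' := 2 * k + b + 5) (b := b) (by omega) (by omega) (by omega)
    (U := fun κ => R.left (κ 1) * R.right (κ (k + b + 3)))
    (V := fun κ => R.left (κ (k + 2)) * R.right (κ (2 * k + b + 4)))
    (s := {1, k + 2, k + b + 3, 2 * k + b + 4})
    (fun κ κ' h => by simp only [h 1 (by simp), h (k + b + 3) (by simp)])
    (fun κ κ' h => by simp only [h (k + 2) (by simp), h (2 * k + b + 4) (by simp)])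
    (fun p hp => by
      rw [hmem, Finset.mem_Icc] at hp
      simp only [Set.mem_insert_iff, Set.mem_singleton_iff]
      omega)
  rw [diagramB_eq_insert, R.aeval_weight hchord, R.diagramVal_eq_contraction hpoints,
    contraction_insert hfresh', funext (R.tr_word_range'_of_four_blocks k b), valB]
  rw [← hD] at hcore
  simp only [contraction_insert hfresh, hcore]
  refine Finset.sum_congr rfl fun s _ => Finset.sum_congr rfl fun t _ => ?_
  simp [Function.update_apply, show k ≠ 2 * k + b + 2 by omega, show k ≠ k + b + 1 by omega]

end Sl2Trace

/-! ### The Kreweras recurrence -/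

theorem weight_diagramA_zero (n : ℕ) : weight (diagramA (n + 1) 0) = X * weight (diagramD n) :=
  eq_of_forall_aeval_irreducible fun d => by
    simp [(irreducible d).aeval_weight_diagramA (b := n) (by omega : 0 + n + 1 = n + 1),
      (irreducible d).aeval_weight_diagramD, (irreducible d).valA_zero_left]

theorem weight_diagramA_self (n : ℕ) : weight (diagramA (n + 1) n) = weight (diagramD (n + 1)) :=
  eq_of_forall_aeval_irreducible fun d => by
    rw [(irreducible d).aeval_weight_diagramA (b := 0) rfl, (irreducible d).aeval_weight_diagramD,
      (irreducible d).valA_zero_right]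

theorem weight_diagramA_one (n : ℕ) :
    weight (diagramA (n + 2) 1) = (X - 1) * weight (diagramD (n + 1)) :=
  eq_of_forall_aeval_irreducible fun d => by
    simp [(irreducible d).aeval_weight_diagramA (b := n) (by omega : 1 + n + 1 = n + 2),
      (irreducible d).aeval_weight_diagramD, (irreducible d).valA_one_left]

theorem weight_diagramB_zero (n : ℕ) :
    weight (diagramB (n + 2) 0) = X ^ 2 * weight (diagramD n) :=
  eq_of_forall_aeval_irreducible fun d => by
    simp [(irreducible d).aeval_weight_diagramB (b := n) (by omega : 0 + n + 2 = n + 2),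
      (irreducible d).aeval_weight_diagramD, (irreducible d).valB_zero_left]

theorem weight_diagramB_self (n : ℕ) :
    weight (diagramB (n + 2) n) = weight (diagramD (n + 2)) + weight (diagramD (n + 1)) :=
  eq_of_forall_aeval_irreducible fun d => by
    simp [(irreducible d).aeval_weight_diagramB (b := 0) rfl,
      (irreducible d).aeval_weight_diagramD, (irreducible d).valB_zero_right]

theorem weight_diagramA_second_difference (k b : ℕ) :
    weight (diagramA (k + b + 3) k) - 2 * weight (diagramA (k + b + 3) (k + 1)) +
        weight (diagramA (k + b + 3) (k + 2)) =
      weight (diagramB (k + b + 2) k) - weight (diagramB (k + b + 2) b) :=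
  eq_of_forall_aeval_irreducible fun d => by
    simp only [map_add, map_sub, map_mul, map_ofNat,
      (irreducible d).aeval_weight_diagramA (by omega : k + (b + 2) + 1 = k + b + 3),
      (irreducible d).aeval_weight_diagramA (by omega : k + 1 + (b + 1) + 1 = k + b + 3),
      (irreducible d).aeval_weight_diagramA (by omega : k + 2 + b + 1 = k + b + 3),
      (irreducible d).aeval_weight_diagramB (by omega : k + b + 2 = k + b + 2),
      (irreducible d).aeval_weight_diagramB (by omega : b + k + 2 = k + b + 2),
      (irreducible d).valA_second_difference]

theorem weight_diagramA_third_difference (k b : ℕ) :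
    weight (diagramA (k + b + 4) k) - 3 * weight (diagramA (k + b + 4) (k + 1)) +
        3 * weight (diagramA (k + b + 4) (k + 2)) - weight (diagramA (k + b + 4) (k + 3)) =
      weight (diagramA (k + b + 3) k) - weight (diagramA (k + b + 3) (k + 2)) +
        2 * X * (weight (diagramA (k + b + 2) k) - weight (diagramA (k + b + 2) (k + 1))) :=
  eq_of_forall_aeval_irreducible fun d => by
    simp only [map_add, map_sub, map_mul, map_ofNat, aeval_X,
      (irreducible d).aeval_weight_diagramA (by omega : k + (b + 3) + 1 = k + b + 4),
      (irreducible d).aeval_weight_diagramA (by omega : k + 1 + (b + 2) + 1 = k + b + 4),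
      (irreducible d).aeval_weight_diagramA (by omega : k + 2 + (b + 1) + 1 = k + b + 4),
      (irreducible d).aeval_weight_diagramA (by omega : k + 3 + b + 1 = k + b + 4),
      (irreducible d).aeval_weight_diagramA (by omega : k + (b + 2) + 1 = k + b + 3),
      (irreducible d).aeval_weight_diagramA (by omega : k + 2 + b + 1 = k + b + 3),
      (irreducible d).aeval_weight_diagramA (by omega : k + (b + 1) + 1 = k + b + 2),
      (irreducible d).aeval_weight_diagramA (by omega : k + 1 + b + 1 = k + b + 2),
      (irreducible d).valA_third_difference]

theorem weight_diagramD_zero : weight (diagramD 0) = 1 := by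
  simp [weight, diagramD, weightAux]

theorem weight_diagramD_one : weight (diagramD 1) = X := by
  rw [← weight_diagramA_self 0, weight_diagramA_zero, weight_diagramD_zero, mul_one]

/-- The difference `A_{n+1,k-1} - A_{n+1,k}`, for `1 ≤ k ≤ n`. The value `1` at `n = 0` is the one
that makes `differenceA_one` hold for all `n`. -/
noncomputable def differenceA (n k : ℕ) : ℤ[X] :=
  if n = 0 then 1 else weight (diagramA (n + 1) (k - 1)) - weight (diagramA (n + 1) k)

theorem differenceA_succ (n k : ℕ) : differenceA (n + 1) (k + 1) =
    weight (diagramA (n + 2) k) - weight (diagramA (n + 2) (k + 1)) := rfl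

theorem differenceA_one (n : ℕ) : differenceA n 1 = weight (diagramD n) := by
  cases n with
  | zero => rw [weight_diagramD_zero]; rfl
  | succ n =>
    rw [differenceA_succ, weight_diagramA_zero (n + 1), weight_diagramA_one]
    ring

theorem sum_differenceA (n : ℕ) : ∑ i ∈ Finset.Icc 1 (n + 1), differenceA (n + 1) i =
    X * weight (diagramD (n + 1)) - weight (diagramD (n + 2)) := by
  calc
    _ = ∑ i ∈ Finset.range (n + 1), differenceA (n + 1) (i + 1) := by
      rw [Finset.range_eq_Ico, Finset.sum_Ico_add' (differenceA (n + 1)) 0 (n + 1) 1]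
      rfl
    _ = weight (diagramA (n + 2) 0) - weight (diagramA (n + 2) (n + 1)) :=
      Finset.sum_range_sub' (fun k => weight (diagramA (n + 2) k)) (n + 1)
    _ = _ := by rw [weight_diagramA_zero, weight_diagramA_self]

theorem differenceA_first (n : ℕ) : differenceA (n + 2) 1 =
    (X - 1) * differenceA (n + 1) 1 - ∑ i ∈ Finset.Icc 2 (n + 1), differenceA (n + 1) i := by
  have h := sum_differenceA n
  rw [← Finset.insert_Icc_succ_left_eq_Icc (by omega), Finset.sum_insert (by simp)] at h
  simp only [differenceA_one, Order.succ_eq_add_one, one_add_one_eq_two] at h ⊢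
  linear_combination h

theorem differenceA_second (n : ℕ) : differenceA (n + 2) 2 =
    2 * differenceA (n + 2) 1 + differenceA (n + 1) 1 - X ^ 2 * differenceA n 1 := by
  have hone := differenceA_one (n + 2)
  have htwo := differenceA_succ (n + 1) 1
  have h := weight_diagramA_second_difference 0 n
  simp only [zero_add, weight_diagramB_zero, weight_diagramB_self] at h
  rw [differenceA_succ] at hone
  rw [differenceA_one, differenceA_one, differenceA_one, htwo]
  linear_combination hone - h

theorem differenceA_add_three {n k : ℕ} (hk : k < n) : differenceA (n + 2) (k + 3) =
    2 * differenceA (n + 2) (k + 2) - differenceA (n + 2) (k + 1) + differenceA (n + 1) (k + 2) +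
      differenceA (n + 1) (k + 1) + 2 * X * differenceA n (k + 1) := by
  obtain ⟨b, rfl⟩ : ∃ b, n = k + b + 1 := ⟨n - k - 1, by omega⟩
  have h := weight_diagramA_third_difference k b
  simp only [differenceA_succ]
  simp only [add_assoc, Nat.reduceAdd] at h ⊢
  linear_combination h

theorem eq_krewerasAux_of_recurrence {K : ℕ → ℕ → ℤ[X]} (hzero : K 0 1 = 1) (hone : K 1 1 = X)
    (hfirst : ∀ n, K (n + 2) 1 = (X - 1) * K (n + 1) 1 - ∑ i ∈ Finset.Icc 2 (n + 1), K (n + 1) i)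
    (hsecond : ∀ n, K (n + 2) 2 = 2 * K (n + 2) 1 + K (n + 1) 1 - X ^ 2 * K n 1)
    (hthree : ∀ n k, k < n → K (n + 2) (k + 3) = 2 * K (n + 2) (k + 2) - K (n + 2) (k + 1) +
      K (n + 1) (k + 2) + K (n + 1) (k + 1) + 2 * X * K n (k + 1))
    {n k : ℕ} (hk : 1 ≤ k) (hkn : k ≤ max 1 n) : K n k = krewerasAux n k := by
  induction n, k using krewerasAux.induct with
  | case1 k =>
    obtain rfl : k = 1 := by omega
    rw [hzero, krewerasAux]
  | case2 k =>
    obtain rfl : k = 1 := by omega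
    rw [hone, krewerasAux]
  | case3 n => omega
  | case4 n ih ih' =>
    rw [hfirst, krewerasAux, ih le_rfl (by omega)]
    congr 1
    refine Finset.sum_congr rfl fun i hi => ?_
    rw [Finset.mem_Icc] at hi
    exact ih' i (by omega) (by omega)
  | case5 n ih ih' ih'' =>
    rw [hsecond, krewerasAux, ih le_rfl (by omega), ih' le_rfl (by omega), ih'' le_rfl (by omega)]
  | case6 n k ih₁ ih₂ ih₃ ih₄ ih₅ =>
    rw [hthree n k (by omega), krewerasAux, ih₁ (by omega) (by omega), ih₂ (by omega) (by omega),
      ih₃ (by omega) (by omega), ih₄ (by omega) (by omega), ih₅ (by omega) (by omega)]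

theorem differenceA_eq_krewerasAux {n k : ℕ} (hk : 1 ≤ k) (hkn : k ≤ max 1 n) :
    differenceA n k = krewerasAux n k :=
  eq_krewerasAux_of_recurrence rfl (by rw [differenceA_one, weight_diagramD_one]) differenceA_first
    differenceA_second (fun _ _ => differenceA_add_three) hk hkn

theorem weight_diagramD_eq_kreweras (n : ℕ) : weight (diagramD n) = kreweras n 1 := by
  rw [← differenceA_one, differenceA_eq_krewerasAux le_rfl (le_max_left 1 n)]
  rfl

theorem weight_diagramA_sub {n k : ℕ} (hk : k < n) :
    weight (diagramA (n + 1) k) - weight (diagramA (n + 1) (k + 1)) = kreweras n (k + 1) := by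
  obtain ⟨n, rfl⟩ := Nat.exists_eq_add_one_of_ne_zero hk.ne_bot
  rw [← differenceA_succ, differenceA_eq_krewerasAux (by omega) (by omega)]
  rfl

theorem polyA_sub {n k : ℕ} (hn : 1 ≤ n) (hk : k ≤ n - 1) :
    polyA n ((k : ℤ) - 1) - polyA n (k : ℤ) = kreweras (n - 1) k := by
  obtain ⟨n, rfl⟩ := Nat.exists_eq_add_of_le' hn
  cases k with
  | zero => simp [polyA, weight_diagramA_zero, weight_diagramD_eq_kreweras, kreweras]
  | succ k =>
    have hk' : ((k + 1 : ℕ) : ℤ) - 1 = k := by push_cast; ring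
    rw [hk', polyA, polyA, if_neg (by omega), if_neg (by omega), Int.toNat_natCast,
      Int.toNat_natCast]
    exact weight_diagramA_sub (by omega)

theorem polyB_sub {n k : ℕ} (hn : 1 ≤ n) (hk : k ≤ n - 1) :
    polyB n ((k : ℤ) - 1) - polyB n ((n : ℤ) - (k : ℤ) - 1) =
      kreweras n k - kreweras n (k + 1) := by
  cases k with
  | zero =>
    have hlast : (n : ℤ) - ((0 : ℕ) : ℤ) - 1 = ((n - 1 : ℕ) : ℤ) := by omega
    rw [hlast, polyB, polyB, if_pos (by simp), if_neg (by omega), Int.toNat_natCast,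
      diagramB_pred_eq_diagramD hn, zero_add, weight_diagramD_eq_kreweras]
    rfl
  | succ k =>
    obtain ⟨b, rfl⟩ : ∃ b, n = k + b + 2 := ⟨n - k - 2, by omega⟩
    have hk' : ((k + 1 : ℕ) : ℤ) - 1 = k := by push_cast; ring
    have hb : ((k + b + 2 : ℕ) : ℤ) - ((k + 1 : ℕ) : ℤ) - 1 = b := by push_cast; ring
    rw [hk', hb, polyB, polyB, if_neg (by omega), if_neg (by omega), Int.toNat_natCast,
      Int.toNat_natCast, ← weight_diagramA_second_difference,
      ← weight_diagramA_sub (n := k + b + 2) (k := k) (by omega),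
      ← weight_diagramA_sub (n := k + b + 2) (k := k + 1) (by omega)]
    ring

end ChordWeight

theorem theorem1 :
    ChordWeight.IsUniversalSl2Weight ChordWeight.weight ∧
    (∀ n k : ℕ, 1 ≤ n → k ≤ n - 1 →
      ChordWeight.polyA n ((k : ℤ) - 1) - ChordWeight.polyA n (k : ℤ)
          = ChordWeight.kreweras (n - 1) k ∧
      ChordWeight.polyB n ((k : ℤ) - 1) - ChordWeight.polyB n ((n : ℤ) - (k : ℤ) - 1)
          = ChordWeight.kreweras n k - ChordWeight.kreweras n (k + 1)) ∧
    (∀ n : ℕ, 1 ≤ n →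
      ChordWeight.weight (ChordWeight.diagramD n) = ChordWeight.kreweras n 1) :=
  ⟨ChordWeight.isUniversalSl2Weight_weight,
    fun _ _ hn hk => ⟨ChordWeight.polyA_sub hn hk, ChordWeight.polyB_sub hn hk⟩,
    fun n _ => ChordWeight.weight_diagramD_eq_kreweras n⟩
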